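/- Let $f:\mathbb R\times\mathbb R\to\mathbb R$ satisfy the following hypotheses: $x\mapsto f(x,\omega)$ is in $L^\infty(\mathbb R)$ for every $\omega$; $\omega\mapsto f(x,\omega)$ is smooth for every $x$; there is $L\ge 0$ with $|f(x,\omega_1)-f(x,\omega_2)|\le L|\omega_1-\omega_2|$ for all $x,\omega_1,\omega_2$; $\int_{\mathbb R}|f(x,0)|\,dx<\infty$; and $$f(x,\omega)=\begin{cases} f_l(\omega), & x\le 0,\\ f_r(\omega), & x>0,\end{cases}$$ where $f_l,f_r:\mathbb R\to\mathbb R$ are smooth with $f_l(0)=f_r(0)=0$ and $f_l(1)=f_r(1)$. Put $D=\{w\in L^1(\mathbb R): 0\le w\le 1 \text{ a.e.}\}$. For $\lambda,\varepsilon>0$ and $w\in L^1(\mathbb R)$, a function $u\in L^1_{\rm loc}(\mathbb R)$ is a weak solution of $u+\lambda[f(x,u)-\varepsilon u_x]_x=w$ if $$\int_{\mathbb R}\Big[\frac{u-w}{\lambda}\,\varphi-f(x,u)\,\varphi'-\varepsilon\,u\,\varphi''\Big]dx=0\qquad\text{for all }\varphi\in C^2_c(\mathbb R).$$ Let $\lambda>0$.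 For every $\varepsilon>0$ and $w\in L^1(\mathbb R)$ there is a unique weak solution in $L^1(\mathbb R)$, denoted $J^\varepsilon_\lambda w$, and $J^\varepsilon_\lambda$ maps $D$ into $D$. For every $w\in D$, $J^\varepsilon_\lambda w$ converges in $L^1(\mathbb R)$, as $\varepsilon\to0^+$, to a unique limit $J_\lambda w\in D$. The map $J_\lambda:D\to D$ is a contraction: $\|J_\lambda w_1-J_\lambda w_2\|_{L^1}\le\|w_1-w_2\|_{L^1}$ for all $w_1,w_2\in D$. -/

import Mathlib

open MeasureTheory Filter Topology
open scoped ContDiff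

/-- Hypothesis `f0` on the flux `f = f(x, s)`. -/
structure FluxF0 (f : ℝ → ℝ → ℝ) : Prop where
  /-- `x ↦ f(x, s)` is in `L^∞(ℝ)` for every `s`. -/
  memLp_top : ∀ s : ℝ, MemLp (fun x => f x s) ⊤ volume
  /-- `s ↦ f(x, s)` is smooth for every `x`. -/
  smooth : ∀ x : ℝ, ContDiff ℝ ∞ (f x)
  /-- `f(x, ·)` is Lipschitz, uniformly in `x`. -/
  lipschitz : ∃ L : ℝ, 0 ≤ L ∧ ∀ x s₁ s₂ : ℝ, |f x s₁ - f x s₂| ≤ L * |s₁ - s₂|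
  /-- `∫ |f(x, 0)| dx` is at most a finite constant. -/
  integral_zero : ∃ L₁ : ℝ, 0 ≤ L₁ ∧ ∫⁻ x, ‖f x 0‖ₑ ≤ ENNReal.ofReal L₁

/-- Hypothesis `f1`: `f` satisfies `f0` and equals `f_l(s)` for `x ≤ 0` and `f_r(s)` for `x > 0`,
with smooth `f_l`, `f_r` that vanish at `0` and agree at `1`. -/
structure FluxF1 (f : ℝ → ℝ → ℝ) : Prop where
  f0 : FluxF0 f
  form : ∃ fl fr : ℝ → ℝ, ContDiff ℝ ∞ fl ∧ ContDiff ℝ ∞ fr ∧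
    (∀ x s : ℝ, f x s = if x ≤ 0 then fl s else fr s) ∧
    fl 0 = 0 ∧ fr 0 = 0 ∧ fl 1 = fr 1

/-- `u ∈ L¹_loc(ℝ)` is a weak solution of the viscous resolvent equation
`u + lam * [f(x, u) - ε u_x]_x = w`. -/
def IsWeakSolution (f : ℝ → ℝ → ℝ) (lam ε : ℝ) (w u : ℝ → ℝ) : Prop :=
  LocallyIntegrable u volume ∧
    ∀ φ : ℝ → ℝ, ContDiff ℝ 2 φ → HasCompactSupport φ →
      ∫ x, ((u x - w x) / lam * φ x - f x (u x) * deriv φ x - ε * u x * deriv (deriv φ) x) = 0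

open Classical in
/-- The viscous resolvent `J^ε_lam w`: the weak solution in `L¹(ℝ)` with datum `w`
(the value `0` is a placeholder for when there is none). -/
noncomputable def viscousResolvent (f : ℝ → ℝ → ℝ) (lam ε : ℝ) (w : ℝ →₁[volume] ℝ) :
    ℝ →₁[volume] ℝ :=
  if h : ∃ u : ℝ →₁[volume] ℝ, IsWeakSolution f lam ε w u then h.choose else 0

/-- The domain `D = {w ∈ L¹(ℝ) : 0 ≤ w ≤ 1}` (almost everywhere). -/
def unitDomain : Set (ℝ →₁[volume] ℝ) :=
  {w | ∀ᵐ x ∂(volume : Measure ℝ), 0 ≤ w x ∧ w x ≤ 1}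

/-! With the total flux `F = f(x, u) - ε u'`, the viscous equation becomes the first-order system `ε
u' = f(x, u) - F`, `lam F' = w - u`, with `F → 0` at both ends (`exists_viscousProfile`). The jump
of `f` in `x` is never differentiated. For two solutions, `d = u₁ - u₂` and `g = -(F₁ - F₂)` satisfy
`|ε d' - g| ≤ L |d|`. Testing `g'` with a smoothed Heaviside function `H_δ(d)` leaves an error of at
most `L² / (4ε) · d² H_δ'(d)`, which vanishes with `δ`. This Kato inequality
(`IsPrimitive.kato_pos`) yields the L¹ contraction, hence uniqueness, and the comparison with the
constant states 0 and 1; the state 1 is stationary because it carries the same flux on both sides of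
the interface.

Existence for small `lam` is a Banach fixed point for the convolution form of the equation; the
resolvent identity, again a Banach fixed point, reaches every `lam`.

For `w` in `D` the family is compact in L¹ as `ε → 0`. Kato's inequality for `u(x + s)` against
`u(x)`, used on each side of the interface, controls translations; mass balance and a bound on the
integral of the flux control the tails (`exists_subseq_cauchy`).

The limit does not depend on the subsequence. Limits `u`, `v` have continuous limiting fluxes `F`,
`G` with `f(x, u) = F` and `f(x, v) = G` a.e. If `G - F` had a positive maximum at `x₀`, then `lam
(G - F)' = u - v` would give `u < v` at some point to the right of `x₀` and `v < u` at some point to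
the left. Near `x₀` the approximate fluxes are strictly separated, and an ODE comparison after
rescaling by the viscosity (`lt_of_viscous_layers`) carries both orderings of the approximations
back to `x₀`, where they contradict each other. So `F = G` and `u = v`. The contraction and the
bounds of `D` pass to the limit. -/

/-! ### Smoothed Heaviside function -/

/-- A `C¹` approximation of the Heaviside function. -/
noncomputable def smoothStep (δ s : ℝ) : ℝ := (max s 0) ^ 2 / ((max s 0) ^ 2 + δ ^ 2)

theorem hasDerivAt_max_zero_sq (s : ℝ) :
    HasDerivAt (fun s : ℝ => (max s 0) ^ 2) (2 * max s 0) s := by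
  rcases lt_trichotomy s 0 with h | h | h
  · have : (fun s : ℝ => (max s 0) ^ 2) =ᶠ[𝓝 s] fun _ => 0 := by
      filter_upwards [gt_mem_nhds h] with t ht
      simp [max_eq_right ht.le]
    rw [max_eq_right h.le, mul_zero]
    exact (hasDerivAt_const s (0 : ℝ)).congr_of_eventuallyEq this
  · subst h
    rw [hasDerivAt_iff_isLittleO_nhds_zero]
    simp only [zero_add, max_self, mul_zero, smul_zero, sub_zero]
    have h2 : (fun h : ℝ => (max h 0) ^ 2 - 0 ^ 2) =O[𝓝 0] fun h : ℝ => h ^ 2 := by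
      refine Asymptotics.IsBigO.of_bound 1 (Eventually.of_forall fun t => ?_)
      rw [one_mul, Real.norm_eq_abs, Real.norm_eq_abs, abs_of_nonneg (by positivity : 0 ≤ t ^ 2)]
      rcases le_total t 0 with h | h
      · simp [max_eq_right h, sq_nonneg]
      · simp [max_eq_left h]
    refine h2.trans_isLittleO ?_
    simpa using (Asymptotics.isLittleO_pow_pow (𝕜 := ℝ) (show 1 < 2 by norm_num))
  · have : (fun s : ℝ => (max s 0) ^ 2) =ᶠ[𝓝 s] fun t => t ^ 2 := by
      filter_upwards [lt_mem_nhds h] with t ht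
      simp [max_eq_left ht.le]
    rw [max_eq_left h.le]
    simpa using (hasDerivAt_pow 2 s).congr_of_eventuallyEq this

/-- The derivative of `smoothStep`. -/
noncomputable def smoothStepDeriv (δ s : ℝ) : ℝ :=
  2 * max s 0 * δ ^ 2 / ((max s 0) ^ 2 + δ ^ 2) ^ 2

theorem hasDerivAt_smoothStep {δ : ℝ} (hδ : 0 < δ) (s : ℝ) :
    HasDerivAt (smoothStep δ) (smoothStepDeriv δ s) s := by
  have h := hasDerivAt_max_zero_sq s
  have hne : (max s 0) ^ 2 + δ ^ 2 ≠ 0 := by positivity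
  refine (h.div (h.add_const (δ ^ 2)) hne).congr_deriv ?_
  unfold smoothStepDeriv
  congr 1
  ring

theorem smoothStep_nonneg (δ s : ℝ) : 0 ≤ smoothStep δ s := by
  unfold smoothStep; positivity

theorem smoothStep_le_one (δ s : ℝ) : smoothStep δ s ≤ 1 := by
  unfold smoothStep
  exact div_le_one_of_le₀ (by nlinarith [sq_nonneg δ]) (by positivity)

theorem smoothStepDeriv_nonneg (δ s : ℝ) : 0 ≤ smoothStepDeriv δ s := by
  unfold smoothStepDeriv; positivity

theorem smoothStepDeriv_le {δ : ℝ} (hδ : 0 < δ) (s : ℝ) : smoothStepDeriv δ s ≤ 1 / δ := by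
  unfold smoothStepDeriv
  set m := max s 0
  have hm : 0 ≤ m := le_max_right _ _
  rw [div_le_div_iff₀ (by positivity) hδ]
  nlinarith [sq_nonneg (m - δ), mul_nonneg hm hδ.le, sq_nonneg (m * δ), sq_nonneg (m * m),
    mul_nonneg (mul_nonneg hδ.le hδ.le) (sq_nonneg (m - δ)), mul_nonneg (sq_nonneg m) (sq_nonneg δ)]

/-- For `s > 0` this is `2 s² δ² ≤ (s² + δ²)²`. The bound is free of `δ`, so it dominates the error
term in Kato's inequality. -/
theorem sq_mul_smoothStepDeriv_le {δ : ℝ} (hδ : 0 < δ) (s : ℝ) :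
    s ^ 2 * smoothStepDeriv δ s ≤ |s| := by
  unfold smoothStepDeriv
  rcases le_total s 0 with h | h
  · simp [max_eq_right h]
  · rw [max_eq_left h, abs_of_nonneg h, ← mul_div_assoc, div_le_iff₀ (by positivity)]
    have : 0 ≤ s * (s ^ 2 - δ ^ 2) ^ 2 := by positivity
    have : 0 ≤ s * (s * δ) ^ 2 := by positivity
    have : 0 ≤ s * (s ^ 2) ^ 2 := by positivity
    have : 0 ≤ s * (δ ^ 2) ^ 2 := by positivity
    nlinarith

theorem tendsto_smoothStep (s : ℝ) :
    Tendsto (fun n : ℕ => smoothStep (1 / ((n : ℝ) + 1)) s) atTop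
      (𝓝 (if 0 < s then 1 else 0)) := by
  have hδ := tendsto_one_div_add_atTop_nhds_zero_nat (𝕜 := ℝ)
  unfold smoothStep
  split_ifs with h
  · have h2 : (max s 0) ^ 2 + 0 ^ 2 ≠ 0 := by rw [max_eq_left h.le]; positivity
    have := (tendsto_const_nhds (x := (max s 0) ^ 2)).div ((hδ.pow 2).const_add ((max s 0) ^ 2)) h2
    refine this.trans (le_of_eq ?_)
    congr 1
    rw [zero_pow two_ne_zero, add_zero] at h2 ⊢
    exact div_self h2
  · simp [max_eq_right (not_lt.1 h)]

theorem tendsto_sq_mul_smoothStepDeriv (s : ℝ) :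
    Tendsto (fun n : ℕ => s ^ 2 * smoothStepDeriv (1 / ((n : ℝ) + 1)) s) atTop (𝓝 0) := by
  have hδ := tendsto_one_div_add_atTop_nhds_zero_nat (𝕜 := ℝ)
  unfold smoothStepDeriv
  rcases le_or_gt s 0 with h | h
  · simp [max_eq_right h]
  · have h2 : ((max s 0) ^ 2 + 0 ^ 2) ^ 2 ≠ 0 := by rw [max_eq_left h.le]; positivity
    have := (((hδ.pow 2).const_mul (2 * max s 0)).div
      (((hδ.pow 2).const_add ((max s 0) ^ 2)).pow 2) h2).const_mul (s ^ 2)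
    simpa using this

theorem continuous_smoothStep {δ : ℝ} (hδ : 0 < δ) : Continuous (smoothStep δ) :=
  continuous_iff_continuousAt.2 fun s => (hasDerivAt_smoothStep hδ s).continuousAt

theorem continuous_smoothStepDeriv {δ : ℝ} (hδ : 0 < δ) : Continuous (smoothStepDeriv δ) := by
  unfold smoothStepDeriv
  refine Continuous.div (by fun_prop) (by fun_prop) fun s => by positivity

theorem lipschitzWith_smoothStep {δ : ℝ} (hδ : 0 < δ) :
    LipschitzWith (Real.toNNReal (1 / δ)) (smoothStep δ) := by
  refine lipschitzWith_of_nnnorm_deriv_le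
    (fun s => (hasDerivAt_smoothStep hδ s).differentiableAt) fun s => ?_
  rw [(hasDerivAt_smoothStep hδ s).deriv, ← NNReal.coe_le_coe, coe_nnnorm,
    Real.coe_toNNReal _ (by positivity), Real.norm_eq_abs,
    abs_of_nonneg (smoothStepDeriv_nonneg _ _)]
  exact smoothStepDeriv_le hδ s

/-! ### Primitives and Kato's inequality -/

/-- `g` is a primitive of the locally integrable function `q`. -/
structure IsPrimitive (g q : ℝ → ℝ) : Prop where
  locallyIntegrable : LocallyIntegrable q volume
  sub_eq : ∀ x y, g y - g x = ∫ t in x..y, q t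

namespace IsPrimitive

variable {g q : ℝ → ℝ}

theorem intervalIntegrable (h : IsPrimitive g q) (a b : ℝ) : IntervalIntegrable q volume a b :=
  intervalIntegrable_iff.2
    ((h.locallyIntegrable.integrableOn_isCompact isCompact_uIcc).mono_set Set.uIoc_subset_uIcc)

theorem eq_add (h : IsPrimitive g q) (a : ℝ) : g = fun x => g a + ∫ t in a..x, q t := by
  funext x
  rw [← h.sub_eq a x]
  ring

theorem continuous (h : IsPrimitive g q) : Continuous g := by
  rw [h.eq_add 0]
  exact continuous_const.add
    (intervalIntegral.continuous_primitive (fun a b => h.intervalIntegrable a b) 0)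

theorem absolutelyContinuous (h : IsPrimitive g q) (a b : ℝ) :
    AbsolutelyContinuousOnInterval g a b := by
  have h1 := (h.intervalIntegrable a b).absolutelyContinuousOnInterval_intervalIntegral
    (c := a) Set.left_mem_uIcc
  have h2 : AbsolutelyContinuousOnInterval (fun _ : ℝ => g a) a b :=
    (LipschitzWith.const (g a)).lipschitzOnWith.absolutelyContinuousOnInterval
  rw [h.eq_add a]
  exact h2.add h1

theorem ae_hasDerivAt (h : IsPrimitive g q) : ∀ᵐ x, HasDerivAt g (q x) x := by
  rw [h.eq_add 0]
  filter_upwards [LocallyIntegrable.ae_hasDerivAt_integral h.locallyIntegrable] with x hx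
  exact (hx 0).const_add _

theorem neg (h : IsPrimitive g q) : IsPrimitive (fun x => -g x) (fun x => -q x) where
  locallyIntegrable := h.locallyIntegrable.neg
  sub_eq x y := by
    rw [intervalIntegral.integral_neg, ← h.sub_eq]
    ring

theorem sub (h : IsPrimitive g q) {g' q' : ℝ → ℝ} (h' : IsPrimitive g' q') :
    IsPrimitive (fun x => g x - g' x) (fun x => q x - q' x) where
  locallyIntegrable := h.locallyIntegrable.sub h'.locallyIntegrable
  sub_eq x y := by
    rw [intervalIntegral.integral_sub (h.intervalIntegrable _ _) (h'.intervalIntegrable _ _),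
      ← h.sub_eq, ← h'.sub_eq]
    ring

theorem comp_add_right (h : IsPrimitive g q) (c : ℝ) :
    IsPrimitive (fun x => g (x + c)) (fun x => q (x + c)) where
  locallyIntegrable := by
    have := (locallyIntegrable_map_homeomorph (Homeomorph.addRight c) (f := q)
      (μ := volume)).1
    rw [Homeomorph.coe_addRight, map_add_right_eq_self] at this
    exact this h.locallyIntegrable
  sub_eq x y := by
    rw [intervalIntegral.integral_comp_add_right (fun x => q x) c, ← h.sub_eq]

/-- Kato's inequality for one component: if `ε d' - g` is controlled by `d`, then `g` decreases
along the set where `d` is positive. -/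
theorem kato_pos {a b ε L : ℝ} (hab : a ≤ b) (hε : 0 < ε) {d p : ℝ → ℝ}
    (hd : IsPrimitive d p) (hg : IsPrimitive g q)
    (hL : ∀ x ∈ Set.Ioc a b, |ε * p x - g x| ≤ L * |d x|) :
    ∫ x in a..b, (if 0 < d x then q x else 0) ≤
      (if 0 < d b then g b else 0) - (if 0 < d a then g a else 0) := by
  have hdc := hd.continuous
  have hgc := hg.continuous
  obtain ⟨Cd, hCd⟩ := isCompact_Icc (a := a) (b := b) |>.exists_bound_of_continuousOn
    hdc.continuousOn
  obtain ⟨Cg, hCg⟩ := isCompact_Icc (a := a) (b := b) |>.exists_bound_of_continuousOn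
    hgc.continuousOn
  -- Since `d` and `g` are bounded on `[a, b]`, `hL` bounds `p` there. So `d` is Lipschitz, its
  -- composition with the smoothed step is absolutely continuous, and integration by parts is
  -- available.
  have hpb : ∀ x ∈ Set.Ioc a b, ‖p x‖ ≤ (Cg + |L| * Cd) / ε := by
    intro x hx
    have h1 := hL x hx
    have h2 := hCd x (Set.Ioc_subset_Icc_self hx)
    have h3 := hCg x (Set.Ioc_subset_Icc_self hx)
    rw [Real.norm_eq_abs] at h2 h3 ⊢
    rw [le_div_iff₀ hε]
    have h4 : |ε * p x| = |p x| * ε := by rw [abs_mul, abs_of_pos hε, mul_comm]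
    have h5 : |ε * p x| ≤ |ε * p x - g x| + |g x| := by
      simpa using abs_add_le (ε * p x - g x) (g x)
    have h6 : L * |d x| ≤ |L| * Cd :=
      mul_le_mul (le_abs_self L) h2 (abs_nonneg _) (abs_nonneg _)
    linarith
  have hdLip : LipschitzOnWith (Real.toNNReal ((Cg + |L| * Cd) / ε)) d (Set.uIcc a b) := by
    refine LipschitzOnWith.of_dist_le_mul fun x hx y hy => ?_
    rw [Set.uIcc_of_le hab] at hx hy
    rw [dist_comm, dist_comm x y, Real.dist_eq, hd.sub_eq, Real.dist_eq, ← Real.norm_eq_abs]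
    refine (intervalIntegral.norm_integral_le_of_norm_le_const fun t ht => ?_).trans
      (mul_le_mul_of_nonneg_right (Real.le_coe_toNNReal _) (abs_nonneg _))
    refine hpb t ?_
    have h1 := Set.uIoc_subset_uIcc ht
    rw [Set.uIoc, Set.mem_Ioc] at ht
    exact ⟨lt_of_le_of_lt (le_min hx.1 hy.1) ht.1, ht.2.trans (max_le hx.2 hy.2)⟩
  set δ : ℕ → ℝ := fun n => 1 / ((n : ℝ) + 1) with hδdef
  have hδ : ∀ n, 0 < δ n := fun n => by positivity
  have key : ∀ n, ∫ x in a..b, q x * smoothStep (δ n) (d x) ≤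
      g b * smoothStep (δ n) (d b) - g a * smoothStep (δ n) (d a) +
        ∫ x in a..b, L ^ 2 / (4 * ε) * (d x ^ 2 * smoothStepDeriv (δ n) (d x)) := by
    intro n
    have hHac : AbsolutelyContinuousOnInterval (fun x => smoothStep (δ n) (d x)) a b :=
      ((lipschitzWith_smoothStep (hδ n)).comp_lipschitzOnWith hdLip).absolutelyContinuousOnInterval
    have hibp := (hg.absolutelyContinuous a b).integral_mul_deriv_eq_deriv_mul hHac
    have e1 : ∫ x in a..b, deriv g x * smoothStep (δ n) (d x) =
        ∫ x in a..b, q x * smoothStep (δ n) (d x) := by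
      refine intervalIntegral.integral_congr_ae ?_
      filter_upwards [hg.ae_hasDerivAt] with x hx _
      rw [hx.deriv]
    rw [e1] at hibp
    have e2 : -∫ x in a..b, g x * deriv (fun x => smoothStep (δ n) (d x)) x ≤
        ∫ x in a..b, L ^ 2 / (4 * ε) * (d x ^ 2 * smoothStepDeriv (δ n) (d x)) := by
      rw [← intervalIntegral.integral_neg]
      refine intervalIntegral.integral_mono_ae_restrict hab ?_ ?_ ?_
      · exact (hHac.intervalIntegrable_deriv.continuousOn_mul hgc.continuousOn).neg
      · exact (((hdc.pow 2).mul ((continuous_smoothStepDeriv (hδ n)).comp hdc)).const_mul _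
          |>.intervalIntegrable _ _)
      · have hne : ∀ᵐ x : ℝ, x ≠ a := by simp [ae_iff, measure_singleton]
        filter_upwards [ae_restrict_mem measurableSet_Icc, ae_restrict_of_ae hne,
          ae_restrict_of_ae hd.ae_hasDerivAt] with x hx hxa hdx
        have h1 := hL x ⟨lt_of_le_of_ne hx.1 hxa.symm, hx.2⟩
        have h2 : HasDerivAt (fun x => smoothStep (δ n) (d x))
          (smoothStepDeriv (δ n) (d x) * p x) x := (hasDerivAt_smoothStep (hδ n) (d x)).comp x hdx
        have h3 := smoothStepDeriv_nonneg (δ n) (d x)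
        -- The constant comes from `(ε p - g)² = (ε p + g)² - 4 ε p g`, with the first square
        -- dropped.
        have h4 : -(g x * p x) ≤ L ^ 2 / (4 * ε) * d x ^ 2 := by
          have h5 : (ε * p x - g x) ^ 2 ≤ L ^ 2 * d x ^ 2 := by
            rw [← sq_abs, ← sq_abs (d x), ← mul_pow]
            exact pow_le_pow_left₀ (abs_nonneg _) h1 2
          rw [div_mul_eq_mul_div, le_div_iff₀ (by positivity)]
          nlinarith [sq_nonneg (ε * p x + g x)]
        simp only [h2.deriv]
        calc _ = -(g x * p x) * smoothStepDeriv (δ n) (d x) := by ring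
          _ ≤ L ^ 2 / (4 * ε) * d x ^ 2 * smoothStepDeriv (δ n) (d x) :=
            mul_le_mul_of_nonneg_right h4 h3
          _ = _ := by ring
    linarith
  have lim1 : Tendsto (fun n => ∫ x in a..b, q x * smoothStep (δ n) (d x)) atTop
      (𝓝 (∫ x in a..b, (if 0 < d x then q x else 0))) := by
    refine intervalIntegral.tendsto_integral_filter_of_dominated_convergence (fun x => |q x|)
      ?_ ?_ (hg.intervalIntegrable a b).abs ?_
    · refine Eventually.of_forall fun n => ?_
      exact (intervalIntegrable_iff.1 (hg.intervalIntegrable a b)).aestronglyMeasurable.mul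
        (((continuous_smoothStep (hδ n)).comp hdc).aestronglyMeasurable)
    · refine Eventually.of_forall fun n => Eventually.of_forall fun x _ => ?_
      rw [norm_mul, Real.norm_eq_abs, Real.norm_eq_abs, abs_of_nonneg (smoothStep_nonneg _ _)]
      exact mul_le_of_le_one_right (abs_nonneg _) (smoothStep_le_one _ _)
    · refine Eventually.of_forall fun x _ => ?_
      simpa [hδdef] using (tendsto_smoothStep (d x)).const_mul (q x)
  have lim2 : Tendsto (fun n => ∫ x in a..b,
      L ^ 2 / (4 * ε) * (d x ^ 2 * smoothStepDeriv (δ n) (d x))) atTop (𝓝 0) := by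
    have : Tendsto (fun n => ∫ x in a..b,
        L ^ 2 / (4 * ε) * (d x ^ 2 * smoothStepDeriv (δ n) (d x))) atTop
        (𝓝 (∫ x in a..b, L ^ 2 / (4 * ε) * 0)) := by
      refine intervalIntegral.tendsto_integral_filter_of_dominated_convergence
        (fun x => L ^ 2 / (4 * ε) * |d x|) ?_ ?_ ?_ ?_
      · exact Eventually.of_forall fun n => (((hdc.pow 2).mul
          ((continuous_smoothStepDeriv (hδ n)).comp hdc)).const_mul _).aestronglyMeasurable
      · refine Eventually.of_forall fun n => Eventually.of_forall fun x _ => ?_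
        have := smoothStepDeriv_nonneg (δ n) (d x)
        rw [Real.norm_eq_abs, abs_of_nonneg (by positivity)]
        exact mul_le_mul_of_nonneg_left (sq_mul_smoothStepDeriv_le (hδ n) _) (by positivity)
      · exact (continuous_const.mul hdc.abs).intervalIntegrable _ _
      · exact Eventually.of_forall fun x _ => (tendsto_sq_mul_smoothStepDeriv (d x)).const_mul _
    simpa using this
  have lim3 : ∀ y, Tendsto (fun n => g y * smoothStep (δ n) (d y)) atTop
      (𝓝 (if 0 < d y then g y else 0)) := fun y => by
    simpa [hδdef] using (tendsto_smoothStep (d y)).const_mul (g y)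
  simpa using le_of_tendsto_of_tendsto' lim1 (((lim3 b).sub (lim3 a)).add lim2) key

end IsPrimitive

/-! ### Test functions and distributional derivatives -/

theorem integral_eq_intervalIntegral_of_forall_abs_le {g : ℝ → ℝ} {R : ℝ}
    (h : ∀ x, R ≤ |x| → g x = 0) : ∫ x, g x = ∫ x in (-R)..R, g x := by
  rw [intervalIntegral.integral_eq_integral_of_support_subset]
  intro x hx
  have := mt (h x) hx
  rw [not_le, abs_lt] at this
  exact ⟨this.1, this.2.le⟩

theorem HasCompactSupport.exists_forall_abs_le {φ : ℝ → ℝ} (h : HasCompactSupport φ) :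
    ∃ R, 0 < R ∧ ∀ x, R ≤ |x| → φ x = 0 := by
  obtain ⟨R, hR, hsub⟩ := h.isCompact.isBounded.subset_ball_lt 0 0
  refine ⟨R, hR, fun x hx => ?_⟩
  by_contra hne
  have := hsub (subset_tsupport φ hne)
  rw [mem_ball_zero_iff, Real.norm_eq_abs] at this
  linarith

theorem IsPrimitive.integral_mul_eq_neg {H r : ℝ → ℝ} (hH : IsPrimitive H r) {φ : ℝ → ℝ}
    (hφ : ContDiff ℝ 1 φ) (hc : HasCompactSupport φ) :
    ∫ x, r x * φ x = -∫ x, H x * deriv φ x := by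
  obtain ⟨R, hR, h1⟩ := hc.exists_forall_abs_le
  obtain ⟨R', hR', h2⟩ := hc.deriv.exists_forall_abs_le
  set S := max R R'
  have h1' : ∀ x, S ≤ |x| → φ x = 0 := fun x hx => h1 x ((le_max_left _ _).trans hx)
  have h2' : ∀ x, S ≤ |x| → deriv φ x = 0 := fun x hx => h2 x ((le_max_right _ _).trans hx)
  rw [integral_eq_intervalIntegral_of_forall_abs_le (R := S) fun x hx => by simp [h1' x hx],
    integral_eq_intervalIntegral_of_forall_abs_le (R := S) fun x hx => by simp [h2' x hx]]
  rw [(hH.absolutelyContinuous _ _).integral_mul_deriv_eq_deriv_mul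
    (hφ.contDiffOn.absolutelyContinuousOnInterval), h1' S (le_abs_self S),
    h1' (-S) (by rw [abs_neg]; exact le_abs_self S)]
  simp only [mul_zero, sub_zero, zero_sub, neg_neg]
  refine intervalIntegral.integral_congr_ae ?_
  filter_upwards [hH.ae_hasDerivAt] with x hx _
  rw [hx.deriv]

/-- The primitive from the left of the support works: it vanishes again to the right because the
total integral is zero. This supplies the test functions for the du Bois-Reymond argument. -/
theorem exists_deriv_eq_of_integral_eq_zero {χ : ℝ → ℝ} (hχ : ContDiff ℝ ∞ χ)
    (hc : HasCompactSupport χ) (h0 : ∫ x, χ x = 0) :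
    ∃ φ : ℝ → ℝ, ContDiff ℝ ∞ φ ∧ HasCompactSupport φ ∧ deriv φ = χ := by
  obtain ⟨R, hR, h1⟩ := hc.exists_forall_abs_le
  have hder : ∀ x, HasDerivAt (fun x => ∫ t in (-R)..x, χ t) (χ x) x := fun x =>
    intervalIntegral.integral_hasDerivAt_right (hχ.continuous.intervalIntegrable _ _)
      (hχ.continuous.stronglyMeasurableAtFilter _ _) hχ.continuous.continuousAt
  have hderiv : deriv (fun x => ∫ t in (-R)..x, χ t) = χ := funext fun x => (hder x).deriv
  refine ⟨fun x => ∫ t in (-R)..x, χ t, ?_, ?_, hderiv⟩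
  · rw [contDiff_infty_iff_deriv, hderiv]
    exact ⟨fun x => (hder x).differentiableAt, hχ⟩
  · refine HasCompactSupport.intro (isCompact_Icc (a := -R) (b := R)) fun x hx => ?_
    rw [Set.mem_Icc, not_and_or, not_le, not_le] at hx
    rcases hx with hx | hx
    · refine intervalIntegral.integral_zero_ae (Eventually.of_forall fun t ht => h1 t ?_)
      rw [Set.uIoc_of_ge hx.le] at ht
      rw [abs_of_nonpos (by linarith [ht.2])]
      linarith [ht.2]
    · rw [integral_eq_intervalIntegral_of_forall_abs_le h1] at h0
      rw [← intervalIntegral.integral_add_adjacent_intervals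
        (hχ.continuous.intervalIntegrable (-R) R) (hχ.continuous.intervalIntegrable R x), h0,
        zero_add]
      refine intervalIntegral.integral_zero_ae (Eventually.of_forall fun t ht => h1 t ?_)
      rw [Set.uIoc_of_le hx.le] at ht
      exact ht.1.le.trans (le_abs_self t)

theorem exists_contDiff_integral_eq_one :
    ∃ ρ : ℝ → ℝ, ContDiff ℝ ∞ ρ ∧ HasCompactSupport ρ ∧ ∫ x, ρ x = 1 := by
  let b : ContDiffBump (0 : ℝ) := default
  exact ⟨b.normed volume, b.contDiff_normed, b.hasCompactSupport_normed, b.integral_normed⟩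

theorem MeasureTheory.LocallyIntegrable.integrable_mul_of_hasCompactSupport {g χ : ℝ → ℝ}
    (hg : LocallyIntegrable g volume) (hχ : Continuous χ) (hc : HasCompactSupport χ) :
    Integrable fun x => g x * χ x := by
  simpa [mul_comm] using hg.integrable_smul_left_of_hasCompactSupport hχ hc

/-- The distributional identity `g = k'` up to a constant. -/
theorem exists_const_of_integral_deriv_add_eq_zero {g k : ℝ → ℝ}
    (hg : LocallyIntegrable g volume) (hk : LocallyIntegrable k volume)
    (h : ∀ φ : ℝ → ℝ, ContDiff ℝ ∞ φ → HasCompactSupport φ →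
      ∫ x, (g x * deriv φ x + k x * deriv (deriv φ) x) = 0) :
    ∃ c : ℝ, ∀ χ : ℝ → ℝ, ContDiff ℝ ∞ χ → HasCompactSupport χ →
      ∫ x, ((g x - c) * χ x + k x * deriv χ x) = 0 := by
  obtain ⟨ρ, hρ, hρc, hρ1⟩ := exists_contDiff_integral_eq_one
  have hint : ∀ χ : ℝ → ℝ, ContDiff ℝ ∞ χ → HasCompactSupport χ →
      Integrable fun x => g x * χ x + k x * deriv χ x := fun χ hχ hχc =>
    (LocallyIntegrable.integrable_mul_of_hasCompactSupport hg hχ.continuous hχc).add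
      (LocallyIntegrable.integrable_mul_of_hasCompactSupport hk
        (hχ.continuous_deriv (by simp)) hχc.deriv)
  -- The constant is the value of the functional `χ ↦ ∫ (g χ + k χ')` at a bump `ρ` of mass one. For
  -- general `χ` of mass `m`, the difference `χ - m ρ` has mass zero, hence is a derivative `φ'`, on
  -- which the functional vanishes by hypothesis.
  refine ⟨∫ x, (g x * ρ x + k x * deriv ρ x), fun χ hχ hχc => ?_⟩
  set c := ∫ x, (g x * ρ x + k x * deriv ρ x) with hcdef
  set m := ∫ x, χ x with hm
  have hχi : Integrable χ := hχ.continuous.integrable_of_hasCompactSupport hχc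
  have hρi : Integrable ρ := hρ.continuous.integrable_of_hasCompactSupport hρc
  have hζ : ContDiff ℝ ∞ fun x => χ x - m * ρ x := hχ.sub (contDiff_const.mul hρ)
  have hζc : HasCompactSupport fun x => χ x - m * ρ x := hχc.sub (hρc.mul_left (f := fun _ => m))
  obtain ⟨φ, hφ, hφc, hφd⟩ := exists_deriv_eq_of_integral_eq_zero hζ hζc (by
    rw [integral_sub hχi (hρi.const_mul m), integral_const_mul, hρ1, ← hm]
    ring)
  have h1 := h φ hφ hφc
  have hd : deriv (fun x => χ x - m * ρ x) = fun x => deriv χ x - m * deriv ρ x := by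
    funext x
    have hχd := (hχ.differentiable (by simp) x).hasDerivAt
    have hρd := (hρ.differentiable (by simp) x).hasDerivAt
    exact (hχd.sub (hρd.const_mul m)).deriv
  rw [hφd, hd] at h1
  have e : ∀ x, (g x - c) * χ x + k x * deriv χ x =
      (g x * (χ x - m * ρ x) + k x * (deriv χ x - m * deriv ρ x)) +
        m * (g x * ρ x + k x * deriv ρ x) - c * χ x := fun x => by ring
  have hi1 : Integrable fun x => g x * (χ x - m * ρ x) + k x * (deriv χ x - m * deriv ρ x) := by
    have := hint _ hζ hζc
    rwa [hd] at this
  have hi2 := (hint ρ hρ hρc).const_mul m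
  simp only [] at h1
  simp_rw [e]
  rw [integral_sub (by exact hi1.add hi2) (hχi.const_mul c),
    integral_add hi1 hi2, h1, integral_const_mul, integral_const_mul,
    ← hcdef, ← hm]
  ring

/-- A locally integrable function with vanishing distributional derivative is constant. -/
theorem ae_eq_const_of_integral_mul_deriv_eq_zero {k : ℝ → ℝ}
    (hk : LocallyIntegrable k volume)
    (h : ∀ φ : ℝ → ℝ, ContDiff ℝ ∞ φ → HasCompactSupport φ → ∫ x, k x * deriv φ x = 0) :
    ∃ c : ℝ, ∀ᵐ x, k x = c := by
  obtain ⟨c, hc⟩ := exists_const_of_integral_deriv_add_eq_zero hk locallyIntegrable_zero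
    fun φ hφ hφc => by simpa using h φ hφ hφc
  refine ⟨c, ?_⟩
  have := ae_eq_zero_of_integral_contDiff_smul_eq_zero (hk.sub (locallyIntegrable_const c))
    fun χ hχ hχc => by simpa [mul_comm] using hc χ hχ hχc
  filter_upwards [this] with x hx
  simpa [sub_eq_zero] using hx

/-! ### Jump fluxes and the first-order system -/

/-- A flux with a jump at `x = 0` that is Lipschitz in the state. -/
structure JumpFlux (f : ℝ → ℝ → ℝ) (fl fr : ℝ → ℝ) (L c : ℝ) : Prop where
  continuous_left : Continuous fl
  continuous_right : Continuous fr
  nonneg : 0 ≤ L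
  lipschitz : ∀ x s t, |f x s - f x t| ≤ L * |s - t|
  eq_ite : ∀ x s, f x s = if x ≤ 0 then fl s else fr s
  zero : ∀ x, f x 0 = 0
  one : ∀ x, f x 1 = c

theorem FluxF1.exists_jumpFlux {f : ℝ → ℝ → ℝ} (hf : FluxF1 f) :
    ∃ fl fr L c, JumpFlux f fl fr L c := by
  obtain ⟨⟨-, -, ⟨L, hL, hlip⟩, -⟩, fl, fr, hl, hr, hform, hl0, hr0, h1⟩ := hf
  refine ⟨fl, fr, L, fl 1, hl.continuous, hr.continuous, hL, hlip, hform, fun x => ?_, fun x => ?_⟩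
  · rw [hform]; split_ifs <;> assumption
  · rw [hform]; split_ifs
    · rfl
    · exact h1.symm

namespace JumpFlux

variable {f : ℝ → ℝ → ℝ} {fl fr : ℝ → ℝ} {L c : ℝ}

theorem abs_le (hf : JumpFlux f fl fr L c) (x s : ℝ) : |f x s| ≤ L * |s| := by
  simpa [hf.zero] using hf.lipschitz x s 0

theorem aestronglyMeasurable (hf : JumpFlux f fl fr L c) {u : ℝ → ℝ}
    (hu : AEStronglyMeasurable u volume) :
    AEStronglyMeasurable (fun x => f x (u x)) volume := by
  have : (fun x => f x (u x)) =
      (Set.Iic (0 : ℝ)).piecewise (fun x => fl (u x)) (fun x => fr (u x)) := by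
    funext x
    simp [Set.piecewise, hf.eq_ite]
  rw [this]
  exact AEStronglyMeasurable.piecewise measurableSet_Iic
    (hf.continuous_left.comp_aestronglyMeasurable hu).restrict
    (hf.continuous_right.comp_aestronglyMeasurable hu).restrict

theorem integrable (hf : JumpFlux f fl fr L c) {u : ℝ → ℝ} (hu : Integrable u) :
    Integrable (fun x => f x (u x)) :=
  (hu.abs.const_mul L).mono' (hf.aestronglyMeasurable hu.aestronglyMeasurable)
    (Eventually.of_forall fun x => hf.abs_le x (u x))

theorem locallyIntegrable (hf : JumpFlux f fl fr L c) {u : ℝ → ℝ} (hu : Continuous u) :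
    LocallyIntegrable (fun x => f x (u x)) :=
  LocallyIntegrable.mono (continuous_const.mul hu).locallyIntegrable
    (hf.aestronglyMeasurable hu.aestronglyMeasurable) (g := fun x => f x (u x)) (f := fun x => L * u x)
    (Eventually.of_forall fun x => by
      rw [Real.norm_eq_abs, Real.norm_eq_abs, abs_mul, abs_of_nonneg hf.nonneg]
      exact hf.abs_le x (u x))

end JumpFlux

/-- The viscous resolvent equation as a first-order system for the state `u` and the total flux
`F = f(x, u) - ε u'`. -/
structure ViscousProfile (f : ℝ → ℝ → ℝ) (lam ε : ℝ) (w u F : ℝ → ℝ) : Prop where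
  integrable_data : Integrable w
  integrable : Integrable u
  flux : IsPrimitive F fun x => (w x - u x) / lam
  state : IsPrimitive u fun x => (f x (u x) - F x) / ε
  tendsto_bot : Tendsto F atBot (𝓝 0)
  tendsto_top : Tendsto F atTop (𝓝 0)

theorem MeasureTheory.LocallyIntegrable.isPrimitive {r : ℝ → ℝ} (hr : LocallyIntegrable r) :
    IsPrimitive (fun x => ∫ t in (0 : ℝ)..x, r t) r where
  locallyIntegrable := hr
  sub_eq x y := by
    have hi : ∀ a b, IntervalIntegrable r volume a b := fun a b => intervalIntegrable_iff.2
      ((hr.integrableOn_isCompact isCompact_uIcc).mono_set Set.uIoc_subset_uIcc)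
    rw [intervalIntegral.integral_interval_sub_left (hi _ _) (hi _ _)]

theorem IsPrimitive.exists_tendsto_atTop {H r : ℝ → ℝ} (h : IsPrimitive H r)
    (hr : Integrable r) : ∃ ℓ, Tendsto H atTop (𝓝 ℓ) := by
  rw [h.eq_add 0]
  exact ⟨_, (intervalIntegral_tendsto_integral_Ioi 0 hr.integrableOn tendsto_id).const_add _⟩

theorem IsPrimitive.exists_tendsto_atBot {H r : ℝ → ℝ} (h : IsPrimitive H r)
    (hr : Integrable r) : ∃ ℓ, Tendsto H atBot (𝓝 ℓ) := by
  rw [h.eq_add 0]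
  simp_rw [intervalIntegral.integral_symm _ (0 : ℝ)]
  exact ⟨_, ((intervalIntegral_tendsto_integral_Iic 0 hr.integrableOn tendsto_id).neg).const_add _⟩

/-- Unit-window means let the limit of the flux be compared with increments `u (x + 1) - u x`,
without any pointwise control of `f(x, u)`. -/
theorem tendsto_integral_unit_interval {l : Filter ℝ} [l.TendstoIxxClass Set.Icc l] {F : ℝ → ℝ}
    {ℓ : ℝ} (hFc : Continuous F) (hF : Tendsto F l (𝓝 ℓ))
    (hl : Tendsto (fun x : ℝ => x + 1) l l) :
    Tendsto (fun x => ∫ t in x..x + 1, F t) l (𝓝 ℓ) := by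
  rw [Metric.tendsto_nhds] at hF ⊢
  intro η hη
  have h1 := ((tendsto_id (α := ℝ) (x := l)).Icc hl).eventually
    (eventually_smallSets_forall.2 (hF (η / 2) (half_pos hη)))
  filter_upwards [h1] with x hx
  have e : ∫ t in x..x + 1, F t = ℓ + ∫ t in x..x + 1, (F t - ℓ) := by
    rw [intervalIntegral.integral_sub (hFc.intervalIntegrable _ _)
      (continuous_const.intervalIntegrable _ _), intervalIntegral.integral_const]
    simp
  have h2 : ‖∫ t in x..x + 1, (F t - ℓ)‖ ≤ η / 2 * |x + 1 - x| := by
    refine intervalIntegral.norm_integral_le_of_norm_le_const fun t ht => ?_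
    rw [Set.uIoc_of_le (by linarith)] at ht
    have := hx t (Set.Ioc_subset_Icc_self ht)
    rw [dist_eq_norm] at this
    exact this.le
  rw [e, Real.dist_eq, add_sub_cancel_left, ← Real.norm_eq_abs]
  refine h2.trans_lt ?_
  rw [add_sub_cancel_left, abs_one, mul_one]
  exact half_lt_self hη

/-- The total flux of an integrable solution vanishes at infinity. -/
theorem eq_zero_of_isPrimitive_of_tendsto {l : Filter ℝ} [l.TendstoIxxClass Set.Icc l]
    {u h F : ℝ → ℝ} {ε ℓ m : ℝ} (hε : ε ≠ 0) (hu : Integrable u) (hh : Integrable h)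
    (hFc : Continuous F) (hp : IsPrimitive u fun x => (h x - F x) / ε)
    (hF : Tendsto F l (𝓝 ℓ)) (hl : Tendsto (fun x : ℝ => x + 1) l l)
    (hH : Tendsto (fun x => ∫ t in (0 : ℝ)..x, h t) l (𝓝 m)) (hinf : ∀ s ∈ l, volume s = ⊤) :
    ℓ = 0 := by
  -- The increment of the primitive of `h` contributes `m - m`, so the increments of `u` tend to `-ℓ
  -- / ε`. They are integrable, and an integrable function can only tend to zero along sets of
  -- infinite measure.
  have h1 : Tendsto (fun x => u (x + 1) - u x) l (𝓝 ((m - m - ℓ) / ε)) := by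
    have h2 := (((hH.comp hl).sub hH).sub (tendsto_integral_unit_interval hFc hF hl)).div_const ε
    refine h2.congr fun x => ?_
    rw [hp.sub_eq, intervalIntegral.integral_div, intervalIntegral.integral_sub
      (hh.intervalIntegrable) (hFc.intervalIntegrable _ _), Function.comp,
      intervalIntegral.integral_interval_sub_left hh.intervalIntegrable hh.intervalIntegrable]
  have h3 : Integrable fun x => u (x + 1) - u x := (hu.comp_add_right 1).sub hu
  have := IntegrableAtFilter.eq_zero_of_tendsto (h3.integrableAtFilter l) hinf h1
  simpa [hε] using this

/-- Two applications of the du Bois-Reymond lemma integrate the equation twice. The result is a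
continuous representative `v` of `u`, on which pointwise arguments can run. -/
theorem exists_viscousProfile {f : ℝ → ℝ → ℝ} {fl fr : ℝ → ℝ} {L c lam ε : ℝ}
    (hf : JumpFlux f fl fr L c) (hε : ε ≠ 0) {w u : ℝ → ℝ} (hw : Integrable w)
    (hu : Integrable u) (h : IsWeakSolution f lam ε w u) :
    ∃ v F, v =ᵐ[volume] u ∧ ViscousProfile f lam ε w v F := by
  obtain ⟨-, h⟩ := h
  have hr : Integrable fun x => (u x - w x) / lam := (hu.sub hw).div_const lam
  have hH := LocallyIntegrable.isPrimitive hr.locallyIntegrable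
  set H : ℝ → ℝ := fun x => ∫ t in (0 : ℝ)..x, (u t - w t) / lam with hHdef
  have hfu := hf.integrable hu
  have hg : LocallyIntegrable (fun x => H x + f x (u x)) :=
    hH.continuous.locallyIntegrable.add hfu.locallyIntegrable
  have hk : LocallyIntegrable (fun x => ε * u x) := (hu.const_mul ε).locallyIntegrable
  have hmul := @LocallyIntegrable.integrable_mul_of_hasCompactSupport
  -- First integration: `ε u' = H + f(x, u) - c₁` in the sense of distributions, so the total flux
  -- is `c₁ - H`.
  obtain ⟨c₁, hc₁⟩ := exists_const_of_integral_deriv_add_eq_zero hg hk fun φ hφ hφc => by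
    have h1 := h φ (by simpa using contDiff_infty.1 hφ 2) hφc
    have hφ' : ContDiff ℝ ∞ (deriv φ) := (contDiff_infty_iff_deriv.1 hφ).2
    have hφ'' : ContDiff ℝ ∞ (deriv (deriv φ)) := (contDiff_infty_iff_deriv.1 hφ').2
    have i1 := hmul hr.locallyIntegrable hφ.continuous hφc
    have i2 := hmul hfu.locallyIntegrable hφ'.continuous hφc.deriv
    have i3 := hmul hk hφ''.continuous hφc.deriv.deriv
    have i4 := hmul hH.continuous.locallyIntegrable hφ'.continuous hφc.deriv
    rw [integral_sub (by exact i1.sub i2) i3, integral_sub i1 i2,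
      hH.integral_mul_eq_neg (hφ.of_le (by simp)) hφc] at h1
    simp_rw [add_mul]
    rw [integral_add (by exact i4.add i2) i3, integral_add i4 i2]
    linarith
  have hKi : LocallyIntegrable fun x => H x + f x (u x) - c₁ := hg.sub (locallyIntegrable_const _)
  have hK := LocallyIntegrable.isPrimitive hKi
  set K : ℝ → ℝ := fun x => ∫ t in (0 : ℝ)..x, (H t + f t (u t) - c₁) with hKdef
  -- Second integration: `ε u - K` is a constant a.e.
  obtain ⟨c₂, hc₂⟩ := ae_eq_const_of_integral_mul_deriv_eq_zero
    (hk.sub hK.continuous.locallyIntegrable) fun χ hχ hχc => by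
    have h1 := hc₁ χ hχ hχc
    have hχ' : ContDiff ℝ ∞ (deriv χ) := (contDiff_infty_iff_deriv.1 hχ).2
    have i1 := hmul hKi hχ.continuous hχc
    have i2 := hmul hk hχ'.continuous hχc.deriv
    have i3 := hmul hK.continuous.locallyIntegrable hχ'.continuous hχc.deriv
    rw [integral_add i1 i2, hK.integral_mul_eq_neg (hχ.of_le (by simp)) hχc] at h1
    simp only [Pi.sub_apply, sub_mul]
    rw [integral_sub i2 i3]
    linarith
  have hae : (fun x => (K x + c₂) / ε) =ᵐ[volume] u := by
    filter_upwards [hc₂] with x hx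
    simp only [Pi.sub_apply] at hx
    rw [div_eq_iff hε]
    linarith
  set v : ℝ → ℝ := fun x => (K x + c₂) / ε with hvdef
  have hv : Integrable v := hu.congr hae.symm
  have hvc : Continuous v := (hK.continuous.add continuous_const).div_const ε
  have hstate : IsPrimitive v fun x => (f x (v x) - (c₁ - H x)) / ε := by
    refine ⟨?_, fun x y => ?_⟩
    · have := LocallyIntegrable.smul ((hf.locallyIntegrable hvc).sub
        ((continuous_const (y := c₁)).sub hH.continuous).locallyIntegrable) ε⁻¹
      refine this.congr (Eventually.of_forall fun x => ?_)
      simp only [Pi.smul_apply, Pi.sub_apply, smul_eq_mul]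
      ring
    · have : ∫ t in x..y, (f t (v t) - (c₁ - H t)) / ε =
          ∫ t in x..y, (H t + f t (u t) - c₁) / ε := by
        refine intervalIntegral.integral_congr_ae ?_
        filter_upwards [hae] with t ht _
        rw [ht]
        ring
      rw [this, intervalIntegral.integral_div, ← hK.sub_eq, hvdef]
      ring
  have hflux : IsPrimitive (fun x => c₁ - H x) fun x => (w x - v x) / lam := by
    refine ⟨((hw.sub hv).div_const lam).locallyIntegrable, fun x y => ?_⟩
    have : ∫ t in x..y, (w t - v t) / lam = -∫ t in x..y, (u t - w t) / lam := by
      rw [← intervalIntegral.integral_neg]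
      refine intervalIntegral.integral_congr_ae ?_
      filter_upwards [hae] with t ht _
      rw [ht]
      ring
    rw [this, ← hH.sub_eq]
    ring
  have hfv := hf.integrable hv
  have hfv' := LocallyIntegrable.isPrimitive hfv.locallyIntegrable
  have hri : Integrable fun x => (w x - v x) / lam := (hw.sub hv).div_const lam
  refine ⟨v, fun x => c₁ - H x, hae, hw, hv, hflux, hstate, ?_, ?_⟩
  · obtain ⟨ℓ, hℓ⟩ := hflux.exists_tendsto_atBot hri
    obtain ⟨m, hm⟩ := hfv'.exists_tendsto_atBot hfv
    have := eq_zero_of_isPrimitive_of_tendsto hε hv hfv hflux.continuous hstate hℓ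
      (tendsto_atBot_add_const_right _ _ tendsto_id) hm fun s hs => by
        obtain ⟨a, ha⟩ := mem_atBot_sets.1 hs
        exact top_unique (Real.volume_Iic (a := a) ▸ measure_mono ha)
    rwa [this] at hℓ
  · obtain ⟨ℓ, hℓ⟩ := hflux.exists_tendsto_atTop hri
    obtain ⟨m, hm⟩ := hfv'.exists_tendsto_atTop hfv
    have := eq_zero_of_isPrimitive_of_tendsto hε hv hfv hflux.continuous hstate hℓ
      (tendsto_atTop_add_const_right _ _ tendsto_id) hm fun s hs => by
        obtain ⟨a, ha⟩ := mem_atTop_sets.1 hs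
        exact top_unique (Real.volume_Ici (a := a) ▸ measure_mono ha)
    rwa [this] at hℓ

/-! ### Contraction and comparison for viscous profiles -/

theorem integrable_ite_pos {d q : ℝ → ℝ} (hd : AEStronglyMeasurable d volume) (hq : Integrable q) :
    Integrable fun x => if 0 < d x then q x else 0 := by
  have hm : NullMeasurableSet {x | 0 < d x} volume :=
    nullMeasurableSet_lt aemeasurable_const hd.aemeasurable
  exact hq.indicator₀ hm

theorem forall_of_ae_of_isClosed {p : ℝ → Prop} (h : ∀ᵐ x, p x) (hc : IsClosed {x | p x})
    (x : ℝ) : p x := by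
  have h1 := (Measure.dense_of_ae h).closure_eq
  rw [hc.closure_eq] at h1
  exact (Set.ext_iff.1 h1 x).2 trivial

namespace ViscousProfile

variable {f : ℝ → ℝ → ℝ} {fl fr : ℝ → ℝ} {L c lam ε : ℝ} {w u F w₁ u₁ F₁ w₂ u₂ F₂ : ℝ → ℝ}

theorem continuous (h : ViscousProfile f lam ε w u F) : Continuous u := h.state.continuous

theorem continuous_flux (h : ViscousProfile f lam ε w u F) : Continuous F := h.flux.continuous

theorem zero (hf : JumpFlux f fl fr L c) : ViscousProfile f lam ε 0 0 0 where
  integrable_data := integrable_zero _ _ _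
  integrable := integrable_zero _ _ _
  flux := ⟨by simpa using locallyIntegrable_zero, by simp⟩
  state := ⟨by simpa [hf.zero] using locallyIntegrable_zero, by simp [hf.zero]⟩
  tendsto_bot := tendsto_const_nhds
  tendsto_top := tendsto_const_nhds

/-- Kato's inequality on `[-R, R]` with `d = u₁ - u₂` and `g = -(F₁ - F₂)`. The difference `ε d' -
g` is exactly `f(x, u₁) - f(x, u₂)`, and the boundary terms disappear as `R → ∞` because both fluxes
tend to zero. -/
theorem integral_ite_pos_le (hf : JumpFlux f fl fr L c) (hlam : 0 < lam) (hε : 0 < ε)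
    (h₁ : ViscousProfile f lam ε w₁ u₁ F₁) (h₂ : ViscousProfile f lam ε w₂ u₂ F₂) :
    ∫ x, (if 0 < u₁ x - u₂ x then (u₁ x - u₂ x) - (w₁ x - w₂ x) else 0) ≤ 0 := by
  have hd := h₁.state.sub h₂.state
  have hg := (h₁.flux.sub h₂.flux).neg
  have hq : Integrable fun x => -((w₁ x - u₁ x) / lam - (w₂ x - u₂ x) / lam) :=
    (((h₁.integrable_data.sub h₁.integrable).div_const lam).sub
      ((h₂.integrable_data.sub h₂.integrable).div_const lam)).neg
  have hqi := integrable_ite_pos hd.continuous.aestronglyMeasurable hq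
  have hlim := intervalIntegral_tendsto_integral hqi tendsto_neg_atTop_atBot tendsto_id
  have hF : ∀ {l : Filter ℝ}, Tendsto F₁ l (𝓝 0) → Tendsto F₂ l (𝓝 0) →
      Tendsto (fun x => |-(F₁ x - F₂ x)|) l (𝓝 0) := fun h h' => by
    simpa using ((h.sub h').neg).abs
  have hz := (hF h₁.tendsto_top h₂.tendsto_top).add
    ((hF h₁.tendsto_bot h₂.tendsto_bot).comp tendsto_neg_atTop_atBot)
  have hle : ∫ x, (if 0 < u₁ x - u₂ x then -((w₁ x - u₁ x) / lam - (w₂ x - u₂ x) / lam) else 0)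
      ≤ 0 + 0 := by
    refine le_of_tendsto_of_tendsto hlim hz ?_
    filter_upwards [eventually_ge_atTop 0] with R hR
    refine (IsPrimitive.kato_pos (by simpa using hR) hε hd hg (L := L) fun x _ => ?_).trans ?_
    · have e : ε * ((f x (u₁ x) - F₁ x) / ε - (f x (u₂ x) - F₂ x) / ε) - -(F₁ x - F₂ x) =
          f x (u₁ x) - f x (u₂ x) := by
        field_simp
        ring
      rw [e]
      exact hf.lipschitz _ _ _
    · simp only [id, Function.comp]
      have a1 := le_abs_self (-(F₁ R - F₂ R))
      have a2 := neg_abs_le (-(F₁ (-R) - F₂ (-R)))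
      have a3 := abs_nonneg (-(F₁ R - F₂ R))
      have a4 := abs_nonneg (-(F₁ (-R) - F₂ (-R)))
      split_ifs <;> linarith
  have e : ∀ x, (if 0 < u₁ x - u₂ x then (u₁ x - u₂ x) - (w₁ x - w₂ x) else 0) =
      lam * (if 0 < u₁ x - u₂ x then -((w₁ x - u₁ x) / lam - (w₂ x - u₂ x) / lam) else 0) := by
    intro x
    split_ifs
    · field_simp
      ring
    · simp
  simp_rw [e]
  rw [integral_const_mul]
  exact mul_nonpos_of_nonneg_of_nonpos hlam.le (by simpa using hle)

theorem integrable_ite (h₁ : ViscousProfile f lam ε w₁ u₁ F₁)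
    (h₂ : ViscousProfile f lam ε w₂ u₂ F₂) :
    Integrable fun x => if 0 < u₁ x - u₂ x then (u₁ x - u₂ x) - (w₁ x - w₂ x) else 0 :=
  integrable_ite_pos (h₁.continuous.sub h₂.continuous).aestronglyMeasurable
    ((h₁.integrable.sub h₂.integrable).sub (h₁.integrable_data.sub h₂.integrable_data))

/-- The one-sided inequality is added to itself with the roles exchanged; pointwise, the sum of the
two integrands is at least `|u₁ - u₂| - |w₁ - w₂|`. -/
theorem integral_abs_sub_le (hf : JumpFlux f fl fr L c) (hlam : 0 < lam) (hε : 0 < ε)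
    (h₁ : ViscousProfile f lam ε w₁ u₁ F₁) (h₂ : ViscousProfile f lam ε w₂ u₂ F₂) :
    ∫ x, |u₁ x - u₂ x| ≤ ∫ x, |w₁ x - w₂ x| := by
  have k₁ := h₁.integral_ite_pos_le hf hlam hε h₂
  have k₂ := h₂.integral_ite_pos_le hf hlam hε h₁
  have iu : Integrable fun x => |u₁ x - u₂ x| := (h₁.integrable.sub h₂.integrable).abs
  have iw : Integrable fun x => |w₁ x - w₂ x| := (h₁.integrable_data.sub h₂.integrable_data).abs
  have := integral_mono (iu.sub iw) ((h₁.integrable_ite h₂).add (h₂.integrable_ite h₁)) fun x => by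
    have a1 := neg_abs_le (w₁ x - w₂ x)
    have a2 := le_abs_self (w₁ x - w₂ x)
    simp only [Pi.sub_apply, Pi.add_apply]
    split_ifs with i1 i2 i2
    · linarith
    · rw [abs_of_pos i1]; linarith
    · rw [abs_of_neg (by linarith)]; linarith
    · rw [show u₁ x - u₂ x = 0 by linarith, abs_zero]; linarith
  simp only [Pi.sub_apply, Pi.add_apply] at this
  rw [integral_sub iu iw, integral_add (h₁.integrable_ite h₂) (h₂.integrable_ite h₁)] at this
  linarith

/-- Comparison with the zero profile: the Kato integrand is `w - u` on `{u < 0}`, positive there,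
yet its integral is at most zero. -/
theorem nonneg (hf : JumpFlux f fl fr L c) (hlam : 0 < lam) (hε : 0 < ε)
    (h : ViscousProfile f lam ε w u F) (hw : ∀ᵐ x, 0 ≤ w x) (x : ℝ) : 0 ≤ u x := by
  have k := (zero hf).integral_ite_pos_le hf hlam hε h
  have hi := (zero (lam := lam) (ε := ε) hf).integrable_ite h
  have hnn : 0 ≤ᵐ[volume] fun x => if 0 < (0 : ℝ → ℝ) x - u x then
      ((0 : ℝ → ℝ) x - u x) - ((0 : ℝ → ℝ) x - w x) else 0 := by
    filter_upwards [hw] with x hx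
    simp only [Pi.zero_apply]
    split_ifs <;> linarith
  have hz := (integral_eq_zero_iff_of_nonneg_ae hnn hi).1 (le_antisymm k (integral_nonneg_of_ae hnn))
  have hae : ∀ᵐ x, 0 ≤ u x := by
    filter_upwards [hz, hw] with x hx hwx
    by_contra hneg
    simp only [Pi.zero_apply] at hx
    rw [if_pos (by linarith)] at hx
    linarith
  exact forall_of_ae_of_isClosed hae (isClosed_le continuous_const h.continuous) x

/-- The constant state 1 is not integrable and hence not a profile, so Kato's inequality is applied
directly to `u - 1` and `-(F - c)`. The boundary terms need not become small; they are removed by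
choosing end points where `u ≤ 1`. -/
theorem le_one (hf : JumpFlux f fl fr L c) (hlam : 0 < lam) (hε : 0 < ε)
    (h : ViscousProfile f lam ε w u F) (hw : ∀ᵐ x, w x ≤ 1) (x : ℝ) : u x ≤ 1 := by
  have hd : IsPrimitive (fun x => u x - 1) fun x => (f x (u x) - F x) / ε :=
    ⟨h.state.locallyIntegrable, fun x y => by rw [← h.state.sub_eq]; ring⟩
  have hg : IsPrimitive (fun x => -(F x - c)) fun x => -((w x - u x) / lam) := by
    refine IsPrimitive.neg ⟨h.flux.locallyIntegrable, fun x y => ?_⟩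
    rw [← h.flux.sub_eq]; ring
  have hq : Integrable fun x => -((w x - u x) / lam) :=
    ((h.integrable_data.sub h.integrable).div_const lam).neg
  have hqi := integrable_ite_pos hd.continuous.aestronglyMeasurable hq
  have hfin : volume {x | 1 ≤ ‖u x‖} < ⊤ := h.integrable.measure_norm_ge_lt_top one_pos
  -- Integrability makes `{u > 1}` of finite measure, so every half-line contains a point where `u ≤
  -- 1`.
  have hsmall : ∀ s : Set ℝ, volume s = ⊤ → ∃ x ∈ s, u x ≤ 1 := by
    intro s hs
    by_contra! hcon
    have : s ⊆ {x | 1 ≤ ‖u x‖} := fun x hx => (hcon x hx).le.trans (le_abs_self _)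
    exact (hs ▸ measure_mono this).not_gt hfin
  choose b hb hb1 using fun n : ℕ => hsmall (Set.Ici (n : ℝ)) Real.volume_Ici
  choose a ha ha1 using fun n : ℕ => hsmall (Set.Iic (-(n : ℝ))) Real.volume_Iic
  have hbt : Tendsto b atTop atTop := tendsto_atTop_mono hb tendsto_natCast_atTop_atTop
  have hat : Tendsto a atTop atBot :=
    tendsto_atBot_mono ha (tendsto_neg_atTop_atBot.comp tendsto_natCast_atTop_atTop)
  have hlim := intervalIntegral_tendsto_integral hqi hat hbt
  have hle : ∫ x, (if 0 < u x - 1 then -((w x - u x) / lam) else 0) ≤ 0 := by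
    refine le_of_tendsto' hlim fun n => ?_
    have hab : a n ≤ b n :=
      (Set.mem_Iic.1 (ha n)).trans ((neg_nonpos.2 n.cast_nonneg).trans
        (n.cast_nonneg.trans (Set.mem_Ici.1 (hb n))))
    refine (IsPrimitive.kato_pos hab hε hd hg (L := L) fun x _ => ?_).trans ?_
    · have e : ε * ((f x (u x) - F x) / ε) - -(F x - c) = f x (u x) - f x 1 := by
        rw [hf.one]
        field_simp
        ring
      rw [e]
      exact hf.lipschitz _ _ _
    · rw [if_neg (by linarith [hb1 n]), if_neg (by linarith [ha1 n]), sub_zero]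
  have hnn : 0 ≤ᵐ[volume] fun x => if 0 < u x - 1 then -((w x - u x) / lam) else 0 := by
    filter_upwards [hw] with x hx
    simp only [Pi.zero_apply]
    split_ifs
    · rw [← neg_div]
      exact div_nonneg (by linarith) hlam.le
    · exact le_rfl
  have hz := (integral_eq_zero_iff_of_nonneg_ae hnn hqi).1
    (le_antisymm hle (integral_nonneg_of_ae hnn))
  have hae : ∀ᵐ x, u x ≤ 1 := by
    filter_upwards [hz, hw] with x hx hwx
    by_contra hneg
    simp only [Pi.zero_apply] at hx
    rw [if_pos (by linarith), neg_eq_zero, div_eq_zero_iff] at hx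
    rcases hx with hx | hx <;> linarith
  exact forall_of_ae_of_isClosed hae (isClosed_le h.continuous continuous_const) x

end ViscousProfile

theorem norm_sub_eq_integral_abs (u v : ℝ →₁[volume] ℝ) : ‖u - v‖ = ∫ x, |u x - v x| := by
  rw [L1.norm_eq_integral_norm]
  refine integral_congr_ae ?_
  filter_upwards [Lp.coeFn_sub u v] with x hx
  rw [hx, Pi.sub_apply, Real.norm_eq_abs]

theorem IsWeakSolution.norm_sub_le {f : ℝ → ℝ → ℝ} {fl fr : ℝ → ℝ} {L c lam ε : ℝ}
    (hf : JumpFlux f fl fr L c) (hlam : 0 < lam) (hε : 0 < ε) {w₁ w₂ u₁ u₂ : ℝ →₁[volume] ℝ}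
    (h₁ : IsWeakSolution f lam ε w₁ u₁) (h₂ : IsWeakSolution f lam ε w₂ u₂) :
    ‖u₁ - u₂‖ ≤ ‖w₁ - w₂‖ := by
  obtain ⟨v₁, F₁, e₁, p₁⟩ := exists_viscousProfile hf hε.ne' (L1.integrable_coeFn w₁)
    (L1.integrable_coeFn u₁) h₁
  obtain ⟨v₂, F₂, e₂, p₂⟩ := exists_viscousProfile hf hε.ne' (L1.integrable_coeFn w₂)
    (L1.integrable_coeFn u₂) h₂
  rw [norm_sub_eq_integral_abs, norm_sub_eq_integral_abs]
  refine le_trans (le_of_eq (integral_congr_ae ?_)) (p₁.integral_abs_sub_le hf hlam hε p₂)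
  filter_upwards [e₁, e₂] with x h1 h2
  rw [h1, h2]

/-! ### Green kernel and existence of the viscous resolvent -/

theorem integral_abs_convolution_le {h k : ℝ → ℝ} (hh : Integrable h) (hk : Integrable k) :
    ∫ x, |convolution h k (ContinuousLinearMap.mul ℝ ℝ) volume x| ≤
      (∫ x, |h x|) * ∫ x, |k x| := by
  have := integral_convolution (ContinuousLinearMap.mul ℝ ℝ) hh.abs hk.abs (μ := volume)
    (ν := volume)
  simp only [ContinuousLinearMap.mul_apply'] at this
  rw [← this]
  refine integral_mono (hh.integrable_convolution _ hk).abs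
    (hh.abs.integrable_convolution _ hk.abs) fun x => ?_
  simp only [convolution, ContinuousLinearMap.mul_apply', ← abs_mul]
  exact abs_integral_le_integral_abs

theorem integral_convolution_mul {h k ψ : ℝ → ℝ} (hh : Integrable h) (hk : Integrable k)
    (hψ : Continuous ψ) (hψc : HasCompactSupport ψ) :
    ∫ x, convolution h k (ContinuousLinearMap.mul ℝ ℝ) volume x * ψ x =
      ∫ t, h t * ∫ x, k (x - t) * ψ x := by
  obtain ⟨C, hC⟩ := hψ.bounded_above_of_compact_support hψc
  have hint := hh.convolution_integrand (ContinuousLinearMap.mul ℝ ℝ) hk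
  simp only [ContinuousLinearMap.mul_apply'] at hint
  have hint2 : Integrable (Function.uncurry fun x t => h t * k (x - t) * ψ x)
      (volume.prod volume) :=
    hint.mul_bdd (c := C) ((hψ.comp continuous_fst).aestronglyMeasurable)
      (Eventually.of_forall fun p => hC p.1)
  simp only [convolution, ContinuousLinearMap.mul_apply', ← integral_mul_const]
  rw [integral_integral_swap hint2]
  refine integral_congr_ae (Eventually.of_forall fun t => ?_)
  simp only [← integral_const_mul]
  refine integral_congr_ae (Eventually.of_forall fun x => ?_)
  simp only []
  ring

/-- The one-sided exponential kernel on `z > 0`. -/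
noncomputable def expRight (κ z : ℝ) : ℝ := if 0 < z then Real.exp (-κ * z) else 0

/-- The one-sided exponential kernel on `z ≤ 0`. -/
noncomputable def expLeft (κ z : ℝ) : ℝ := if 0 < z then 0 else Real.exp (κ * z)

theorem expRight_eq (κ : ℝ) :
    expRight κ = (Set.Ioi (0 : ℝ)).indicator fun z => Real.exp (-κ * z) := by
  funext z; simp [expRight, Set.indicator]

theorem expLeft_eq (κ : ℝ) :
    expLeft κ = (Set.Iic (0 : ℝ)).indicator fun z => Real.exp (κ * z) := by
  funext z
  simp only [expLeft, Set.indicator, Set.mem_Iic]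
  split_ifs <;> first | rfl | linarith

theorem integrable_expRight {κ : ℝ} (hκ : 0 < κ) : Integrable (expRight κ) := by
  rw [expRight_eq, integrable_indicator_iff measurableSet_Ioi]
  exact exp_neg_integrableOn_Ioi 0 hκ

theorem integrable_expLeft {κ : ℝ} (hκ : 0 < κ) : Integrable (expLeft κ) := by
  rw [expLeft_eq, integrable_indicator_iff measurableSet_Iic]
  exact integrableOn_exp_mul_Iic hκ 0

theorem integral_expRight {κ : ℝ} (hκ : 0 < κ) : ∫ z, expRight κ z = 1 / κ := by
  rw [expRight_eq, integral_indicator measurableSet_Ioi, integral_exp_mul_Ioi (by linarith)]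
  simp

theorem integral_expLeft {κ : ℝ} (hκ : 0 < κ) : ∫ z, expLeft κ z = 1 / κ := by
  rw [expLeft_eq, integral_indicator measurableSet_Iic, integral_exp_mul_Iic hκ]
  simp

/-- A primitive of `e^{σ (x - t)} (φ - φ'' / σ²)`. -/
theorem deriv_exp_mul_sub {σ : ℝ} (hσ : σ ≠ 0) {φ : ℝ → ℝ} (hφ : ContDiff ℝ 2 φ) (t : ℝ) :
    deriv (fun x => Real.exp (σ * (x - t)) * (φ x / σ - deriv φ x / σ ^ 2)) =
      fun x => Real.exp (σ * (x - t)) * (φ x - deriv (deriv φ) x / σ ^ 2) := by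
  funext x
  have h1 := (hφ.differentiable (by simp) x).hasDerivAt
  have h2 := ((contDiff_succ_iff_deriv (n := 1)).1 hφ).2.2.differentiable (by simp) x |>.hasDerivAt
  have h3 : HasDerivAt (fun x => Real.exp (σ * (x - t))) (Real.exp (σ * (x - t)) * (σ * 1)) x :=
    (((hasDerivAt_id x).sub_const t).const_mul σ).exp
  refine (h3.mul ((h1.div_const σ).sub (h2.div_const (σ ^ 2)))).deriv.trans ?_
  simp only [Pi.sub_apply]
  field_simp
  ring

theorem contDiff_exp_mul_sub {σ : ℝ} {φ : ℝ → ℝ} (hφ : ContDiff ℝ 2 φ) (t : ℝ) :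
    ContDiff ℝ 1 fun x => Real.exp (σ * (x - t)) * (φ x / σ - deriv φ x / σ ^ 2) := by
  have h2 := ((contDiff_succ_iff_deriv (n := 1)).1 hφ).2.2
  have h1 : ContDiff ℝ 1 φ := hφ.of_le (by norm_num)
  fun_prop

theorem hasCompactSupport_exp_mul_sub {σ : ℝ} {φ : ℝ → ℝ} (hc : HasCompactSupport φ) (t : ℝ) :
    HasCompactSupport fun x => Real.exp (σ * (x - t)) * (φ x / σ - deriv φ x / σ ^ 2) := by
  simp only [div_eq_mul_inv]
  exact HasCompactSupport.mul_left (HasCompactSupport.sub hc.mul_right hc.deriv.mul_right)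

theorem integral_expRight_mul {κ : ℝ} (hκ : 0 < κ) {φ : ℝ → ℝ} (hφ : ContDiff ℝ 2 φ)
    (hc : HasCompactSupport φ) (t : ℝ) :
    ∫ x, expRight κ (x - t) * (φ x - deriv (deriv φ) x / κ ^ 2) =
      φ t / κ + deriv φ t / κ ^ 2 := by
  have h := (hasCompactSupport_exp_mul_sub (σ := -κ) hc t).integral_Ioi_deriv_eq
    (contDiff_exp_mul_sub hφ t) t
  rw [deriv_exp_mul_sub (neg_ne_zero.2 hκ.ne') hφ, ← integral_indicator measurableSet_Ioi] at h
  refine Eq.trans (integral_congr_ae (Eventually.of_forall fun x => ?_)) (h.trans ?_)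
  · simp only [expRight, Set.indicator, Set.mem_Ioi, sub_pos, neg_sq]
    split_ifs <;> simp
  · simp only [sub_self, mul_zero, Real.exp_zero, one_mul, neg_sq, div_neg]
    ring

theorem integral_expLeft_mul {κ : ℝ} (hκ : 0 < κ) {φ : ℝ → ℝ} (hφ : ContDiff ℝ 2 φ)
    (hc : HasCompactSupport φ) (t : ℝ) :
    ∫ x, expLeft κ (x - t) * (φ x - deriv (deriv φ) x / κ ^ 2) =
      φ t / κ - deriv φ t / κ ^ 2 := by
  have h := (hasCompactSupport_exp_mul_sub (σ := κ) hc t).integral_Iic_deriv_eq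
    (contDiff_exp_mul_sub hφ t) t
  rw [deriv_exp_mul_sub hκ.ne' hφ, ← integral_indicator measurableSet_Iic] at h
  refine Eq.trans (integral_congr_ae (Eventually.of_forall fun x => ?_)) (h.trans ?_)
  · simp only [expLeft, Set.indicator, Set.mem_Iic, sub_pos]
    split_ifs
    · linarith
    · simp
    · rfl
    · linarith
  · simp only [sub_self, mul_zero, Real.exp_zero, one_mul]

/-- The Green function of `1 - κ⁻² ∂²`. -/
noncomputable def greenKernel (κ z : ℝ) : ℝ := κ / 2 * (expRight κ z + expLeft κ z)

/-- The kernel of `-κ⁻² ∂ (1 - κ⁻² ∂²)⁻¹`, up to the factor `2`. -/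
noncomputable def greenKernelDeriv (κ z : ℝ) : ℝ := expRight κ z - expLeft κ z

theorem integrable_greenKernel {κ : ℝ} (hκ : 0 < κ) : Integrable (greenKernel κ) :=
  ((integrable_expRight hκ).add (integrable_expLeft hκ)).const_mul _

theorem integrable_greenKernelDeriv {κ : ℝ} (hκ : 0 < κ) : Integrable (greenKernelDeriv κ) :=
  (integrable_expRight hκ).sub (integrable_expLeft hκ)

theorem integral_abs_greenKernelDeriv_le {κ : ℝ} (hκ : 0 < κ) :
    ∫ z, |greenKernelDeriv κ z| ≤ 2 / κ := by
  have : (2 : ℝ) / κ = ∫ z, (expRight κ z + expLeft κ z) := by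
    rw [integral_add (integrable_expRight hκ) (integrable_expLeft hκ), integral_expRight hκ,
      integral_expLeft hκ]
    ring
  rw [this]
  refine integral_mono (integrable_greenKernelDeriv hκ).abs
    ((integrable_expRight hκ).add (integrable_expLeft hκ)) fun z => ?_
  simp only [greenKernelDeriv, expRight, expLeft]
  split_ifs
  · simp
  · simp

section
variable {κ : ℝ} {φ : ℝ → ℝ}

theorem integrable_kernel_mul {k ψ : ℝ → ℝ} (hk : Integrable k) (hψ : Continuous ψ)
    (hψc : HasCompactSupport ψ) (t : ℝ) : Integrable fun x => k (x - t) * ψ x := by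
  obtain ⟨C, hC⟩ := hψ.bounded_above_of_compact_support hψc
  exact (hk.comp_sub_right t).mul_bdd (c := C) hψ.aestronglyMeasurable (Eventually.of_forall hC)

theorem continuous_resolvent_test (hφ : ContDiff ℝ 2 φ) :
    Continuous fun x => φ x - deriv (deriv φ) x / κ ^ 2 := by
  have h2 := ((contDiff_succ_iff_deriv (n := 1)).1 hφ).2.2
  exact hφ.continuous.sub ((h2.continuous_deriv le_rfl).div_const _)

theorem hasCompactSupport_resolvent_test (hc : HasCompactSupport φ) :
    HasCompactSupport fun x => φ x - deriv (deriv φ) x / κ ^ 2 := by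
  simp only [div_eq_mul_inv]
  exact HasCompactSupport.sub hc hc.deriv.deriv.mul_right

theorem integral_greenKernel_mul (hκ : 0 < κ) (hφ : ContDiff ℝ 2 φ)
    (hc : HasCompactSupport φ) (t : ℝ) :
    ∫ x, greenKernel κ (x - t) * (φ x - deriv (deriv φ) x / κ ^ 2) = φ t := by
  have i1 := integrable_kernel_mul (integrable_expRight hκ)
    (continuous_resolvent_test (κ := κ) hφ) (hasCompactSupport_resolvent_test hc) t
  have i2 := integrable_kernel_mul (integrable_expLeft hκ)
    (continuous_resolvent_test (κ := κ) hφ) (hasCompactSupport_resolvent_test hc) t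
  simp only [greenKernel, mul_assoc, add_mul]
  rw [integral_const_mul, integral_add i1 i2, integral_expRight_mul hκ hφ hc,
    integral_expLeft_mul hκ hφ hc]
  field_simp
  ring

theorem integral_greenKernelDeriv_mul (hκ : 0 < κ) (hφ : ContDiff ℝ 2 φ)
    (hc : HasCompactSupport φ) (t : ℝ) :
    ∫ x, greenKernelDeriv κ (x - t) * (φ x - deriv (deriv φ) x / κ ^ 2) =
      2 * deriv φ t / κ ^ 2 := by
  have i1 := integrable_kernel_mul (integrable_expRight hκ)
    (continuous_resolvent_test (κ := κ) hφ) (hasCompactSupport_resolvent_test hc) t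
  have i2 := integrable_kernel_mul (integrable_expLeft hκ)
    (continuous_resolvent_test (κ := κ) hφ) (hasCompactSupport_resolvent_test hc) t
  simp only [greenKernelDeriv, sub_mul]
  rw [integral_sub i1 i2, integral_expRight_mul hκ hφ hc, integral_expLeft_mul hκ hφ hc]
  ring

end

/-- With `κ⁻² = lam ε`, inverting `1 - lam ε ∂²` turns the equation into the fixed point problem `u
= T u`. The nonlinear kernel has L¹ norm at most `1 / (ε κ)`, so `T` has Lipschitz constant `L / (ε
κ) = L √(lam / ε)`, which `hsmall` makes less than one. -/
theorem exists_isWeakSolution_of_small {f : ℝ → ℝ → ℝ} {fl fr : ℝ → ℝ} {L c lam ε : ℝ}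
    (hf : JumpFlux f fl fr L c) (hlam : 0 < lam) (hε : 0 < ε) (hsmall : L ^ 2 * lam < ε)
    (w : ℝ →₁[volume] ℝ) : ∃ u : ℝ →₁[volume] ℝ, IsWeakSolution f lam ε w u := by
  set κ : ℝ := 1 / Real.sqrt (lam * ε) with hκdef
  have hκ : 0 < κ := by positivity
  have hκ2 : κ ^ 2 = 1 / (lam * ε) := by
    rw [hκdef, div_pow, Real.sq_sqrt (by positivity), one_pow]
  set cv : (ℝ → ℝ) → (ℝ → ℝ) → ℝ → ℝ := fun h k =>
    convolution h k (ContinuousLinearMap.mul ℝ ℝ) volume with hcv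
  have hcvi : ∀ {h k : ℝ → ℝ}, Integrable h → Integrable k → Integrable (cv h k) :=
    fun hh hk => hh.integrable_convolution _ hk
  have hG := integrable_greenKernel hκ
  have hB := integrable_greenKernelDeriv hκ
  have hT : ∀ u : ℝ →₁[volume] ℝ, Integrable fun x => cv w (greenKernel κ) x +
      1 / (2 * ε) * cv (fun x => f x (u x)) (greenKernelDeriv κ) x := fun u =>
    (hcvi (L1.integrable_coeFn w) hG).add
      ((hcvi (hf.integrable (L1.integrable_coeFn u)) hB).const_mul _)
  set T : (ℝ →₁[volume] ℝ) → (ℝ →₁[volume] ℝ) := fun u => (hT u).toL1 with hTdef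
  set K : ℝ := L / (ε * κ) with hKdef
  have hL := hf.nonneg
  have hK0 : 0 ≤ K := by positivity
  have hK1 : K < 1 := by
    rw [hKdef, div_lt_one (by positivity)]
    refine lt_of_pow_lt_pow_left₀ 2 (by positivity) ?_
    rw [mul_pow, hκ2]
    have : ε ^ 2 * (1 / (lam * ε)) = ε / lam := by field_simp
    rw [this, lt_div_iff₀ hlam]
    exact hsmall
  have hcontr : ContractingWith (Real.toNNReal K) T := by
    refine ⟨by simpa using hK1, LipschitzWith.of_dist_le_mul fun u v => ?_⟩
    rw [dist_eq_norm, dist_eq_norm, Real.coe_toNNReal _ hK0, norm_sub_eq_integral_abs,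
      norm_sub_eq_integral_abs]
    have hfu := hf.integrable (L1.integrable_coeFn u)
    have hfv := hf.integrable (L1.integrable_coeFn v)
    have e1 : ∫ x, |T u x - T v x| = ∫ x, 1 / (2 * ε) *
        |cv (fun x => f x (u x) - f x (v x)) (greenKernelDeriv κ) x| := by
      refine integral_congr_ae ?_
      filter_upwards [(hT u).coeFn_toL1, (hT v).coeFn_toL1,
        hfu.ae_convolution_exists (ContinuousLinearMap.mul ℝ ℝ) hB,
        hfv.ae_convolution_exists (ContinuousLinearMap.mul ℝ ℝ) hB] with x hx hy h1 h2
      have h3 : cv (fun x => f x (u x) - f x (v x)) (greenKernelDeriv κ) x =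
          cv (fun x => f x (u x)) (greenKernelDeriv κ) x -
            cv (fun x => f x (v x)) (greenKernelDeriv κ) x := by
        simp only [hcv, convolution_def]
        rw [← integral_sub h1 h2]
        simp
      rw [hx, hy, h3, ← abs_of_pos (show 0 < 1 / (2 * ε) by positivity), ← abs_mul,
        abs_of_pos (show 0 < 1 / (2 * ε) by positivity)]
      congr 1
      ring
    rw [e1, integral_const_mul]
    have h4 := integral_abs_convolution_le (hfu.sub hfv) hB
    have h5 : ∫ x, |((fun x => f x (u x)) - fun x => f x (v x)) x| ≤ L * ∫ x, |u x - v x| := by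
      rw [← integral_const_mul]
      exact integral_mono (hfu.sub hfv).abs
        (((L1.integrable_coeFn u).sub (L1.integrable_coeFn v)).abs.const_mul L)
        fun x => hf.lipschitz x (u x) (v x)
    have h6 : 0 ≤ ∫ x, |u x - v x| := integral_nonneg fun x => abs_nonneg _
    have h7 := mul_le_mul h5 (integral_abs_greenKernelDeriv_le hκ)
      (integral_nonneg fun x => abs_nonneg _) (mul_nonneg hL h6)
    calc _ ≤ 1 / (2 * ε) * (L * (∫ x, |u x - v x|) * (2 / κ)) :=
          mul_le_mul_of_nonneg_left (h4.trans h7) (by positivity)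
      _ = _ := by rw [hKdef]; field_simp
  set u := hcontr.fixedPoint T with hu
  have hfix : T u = u := hcontr.fixedPoint_isFixedPt
  have hui := L1.integrable_coeFn u
  have hwi := L1.integrable_coeFn w
  have hfu := hf.integrable hui
  refine ⟨u, hui.locallyIntegrable, fun φ hφ hc => ?_⟩
  have hψ := continuous_resolvent_test (κ := κ) hφ
  have hψc := hasCompactSupport_resolvent_test (κ := κ) hc
  have hφ' := ((contDiff_succ_iff_deriv (n := 1)).1 hφ).2.2
  have hmul := @LocallyIntegrable.integrable_mul_of_hasCompactSupport
  -- The fixed point equation is tested against `φ - φ'' / κ²`; the kernels turn this function back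
  -- into `φ` and `2 φ' / κ²`.
  have h1 : ∫ x, u x * (φ x - deriv (deriv φ) x / κ ^ 2) =
      (∫ x, w x * φ x) + lam * ∫ x, f x (u x) * deriv φ x := by
    have e1 : ∫ x, u x * (φ x - deriv (deriv φ) x / κ ^ 2) =
        ∫ x, (cv w (greenKernel κ) x * (φ x - deriv (deriv φ) x / κ ^ 2) +
          1 / (2 * ε) * (cv (fun x => f x (u x)) (greenKernelDeriv κ) x *
            (φ x - deriv (deriv φ) x / κ ^ 2))) := by
      refine integral_congr_ae ?_
      filter_upwards [(hT u).coeFn_toL1] with x hx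
      have : u x = T u x := by rw [hfix]
      rw [this, hx]
      ring
    rw [e1, integral_add (hmul (hcvi hwi hG).locallyIntegrable hψ hψc)
      ((hmul (hcvi hfu hB).locallyIntegrable hψ hψc).const_mul _), integral_const_mul,
      integral_convolution_mul hwi hG hψ hψc, integral_convolution_mul hfu hB hψ hψc]
    simp only [integral_greenKernel_mul hκ hφ hc, integral_greenKernelDeriv_mul hκ hφ hc]
    congr 1
    rw [← integral_const_mul, ← integral_const_mul]
    refine integral_congr_ae (Eventually.of_forall fun x => ?_)
    simp only [hκ2]
    field_simp
  have i1 := hmul hui.locallyIntegrable hφ.continuous hc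
  have i2 := hmul hwi.locallyIntegrable hφ.continuous hc
  have i3 := hmul hfu.locallyIntegrable hφ'.continuous hc.deriv
  have i4 := hmul hui.locallyIntegrable (hφ'.continuous_deriv le_rfl) hc.deriv.deriv
  have e2 : ∀ x, (u x - w x) / lam * φ x - f x (u x) * deriv φ x - ε * u x * deriv (deriv φ) x =
      1 / lam * (u x * (φ x - deriv (deriv φ) x / κ ^ 2)) - 1 / lam * (w x * φ x) -
        f x (u x) * deriv φ x := by
    intro x
    rw [hκ2]
    field_simp
    ring
  simp_rw [e2]
  have i5 := (hmul hui.locallyIntegrable hψ hψc).const_mul (1 / lam)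
  have i6 := i2.const_mul (1 / lam)
  rw [integral_sub (by exact i5.sub i6) i3, integral_sub i5 i6, integral_const_mul,
    integral_const_mul, h1]
  field_simp
  ring

/-- Resolvent identity: `u` solves the problem for `lam` and `w` exactly when it solves the problem
for `μ` and the datum `(μ / lam) w + (1 - μ / lam) u`. For small `μ` the latter is solvable and
nonexpansive in its datum, so `u` is the fixed point of a contraction with factor `1 - μ / lam`. -/
theorem exists_isWeakSolution {f : ℝ → ℝ → ℝ} {fl fr : ℝ → ℝ} {L c lam ε : ℝ}
    (hf : JumpFlux f fl fr L c) (hlam : 0 < lam) (hε : 0 < ε)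
    (w : ℝ →₁[volume] ℝ) : ∃ u : ℝ →₁[volume] ℝ, IsWeakSolution f lam ε w u := by
  obtain ⟨μ, hμ, hμlam, hμε⟩ : ∃ μ, 0 < μ ∧ μ < lam ∧ L ^ 2 * μ < ε := by
    -- The summand 1 keeps the denominator positive when `L = 0`.
    refine ⟨min (lam / 2) (ε / (2 * (L ^ 2 + 1))), by positivity, ?_, ?_⟩
    · exact (min_le_left _ _).trans_lt (half_lt_self hlam)
    · have h1 : L ^ 2 * min (lam / 2) (ε / (2 * (L ^ 2 + 1))) ≤
          L ^ 2 * (ε / (2 * (L ^ 2 + 1))) :=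
        mul_le_mul_of_nonneg_left (min_le_right _ _) (sq_nonneg L)
      refine h1.trans_lt ?_
      rw [mul_div_assoc', div_lt_iff₀ (by positivity)]
      nlinarith [mul_nonneg hε.le (sq_nonneg L)]
  choose J hJ using exists_isWeakSolution_of_small hf hμ hε hμε
  set K : ℝ := 1 - μ / lam with hK
  have hK0 : 0 ≤ K := by rw [hK, sub_nonneg, div_le_one hlam]; exact hμlam.le
  have hK1 : K < 1 := by rw [hK, sub_lt_self_iff]; positivity
  have hcontr : ContractingWith (Real.toNNReal K)
      fun u : ℝ →₁[volume] ℝ => J ((μ / lam) • w + K • u) := by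
    refine ⟨by simpa using hK1, LipschitzWith.of_dist_le_mul fun u v => ?_⟩
    rw [dist_eq_norm, dist_eq_norm, Real.coe_toNNReal _ hK0]
    refine ((hJ _).norm_sub_le hf hμ hε (hJ _)).trans (le_of_eq ?_)
    rw [add_sub_add_left_eq_sub, ← smul_sub, norm_smul, Real.norm_of_nonneg hK0]
  set u := hcontr.fixedPoint _ with hu
  have hfix : J ((μ / lam) • w + K • u) = u := hcontr.fixedPoint_isFixedPt
  have hJu := hJ ((μ / lam) • w + K • u)
  rw [hfix] at hJu
  refine ⟨u, hJu.1, fun φ hφ hc => Eq.trans (integral_congr_ae ?_) (hJu.2 φ hφ hc)⟩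
  filter_upwards [Lp.coeFn_add ((μ / lam) • w) (K • u), Lp.coeFn_smul (μ / lam) w,
    Lp.coeFn_smul K u] with x h1 h2 h3
  rw [h1, Pi.add_apply, h2, h3, Pi.smul_apply, Pi.smul_apply, smul_eq_mul, smul_eq_mul, hK]
  congr 2
  field_simp
  ring

/-! ### Translation and tail estimates uniform in the viscosity -/

/-- Kato's inequality on an interval, with the fluxes at the end points. -/
theorem IsPrimitive.kato_abs {a b ε L lam : ℝ} (hab : a ≤ b) (hε : 0 < ε) (hlam : 0 < lam)
    {d p g k : ℝ → ℝ} (hd : IsPrimitive d p) (hg : IsPrimitive g fun x => (d x - k x) / lam)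
    (hk : IntervalIntegrable k volume a b)
    (hL : ∀ x ∈ Set.Ioc a b, |ε * p x - g x| ≤ L * |d x|) :
    ∫ x in a..b, |d x| ≤ (∫ x in a..b, |k x|) + lam * (|g a| + |g b|) := by
  have k₁ := IsPrimitive.kato_pos hab hε hd hg hL
  have k₂ := IsPrimitive.kato_pos hab hε hd.neg hg.neg (L := L) fun x hx => by
    rw [abs_neg, ← abs_neg]
    convert hL x hx using 2
    ring
  have hqi := hg.intervalIntegrable a b
  have hite : ∀ {e q : ℝ → ℝ}, Continuous e → IntervalIntegrable q volume a b →
      IntervalIntegrable (fun x => if 0 < e x then q x else 0) volume a b := by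
    intro e q he hq
    rw [intervalIntegrable_iff] at hq ⊢
    exact hq.indicator (measurableSet_lt measurable_const he.measurable)
  have i₁ := hite hd.continuous hqi
  have i₂ := hite (e := fun x => -d x) (q := fun x => -((d x - k x) / lam)) hd.continuous.neg hqi.neg
  have iu : IntervalIntegrable (fun x => |d x|) volume a b := hd.continuous.abs.intervalIntegrable _ _
  have hm := intervalIntegral.integral_mono_on hab (iu.sub hk.abs) ((i₁.add i₂).const_mul lam)
    fun x _ => by
    have a1 := neg_abs_le (k x)
    have a2 := le_abs_self (k x)
    have a3 : lam * ((d x - k x) / lam) = d x - k x := by field_simp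
    split_ifs with i1 i2 i2
    · linarith
    · rw [abs_of_pos i1, add_zero, a3]; linarith
    · rw [abs_of_neg (by linarith), zero_add, mul_neg, a3]; linarith
    · rw [show d x = 0 by linarith, abs_zero]; linarith
  rw [intervalIntegral.integral_sub iu hk.abs, intervalIntegral.integral_const_mul,
    intervalIntegral.integral_add i₁ i₂] at hm
  have hb : (if 0 < d b then g b else 0) - (if 0 < d a then g a else 0) +
      ((if 0 < -d b then -g b else 0) - (if 0 < -d a then -g a else 0)) ≤ |g a| + |g b| := by
    have a1 := neg_abs_le (g a)
    have a2 := le_abs_self (g a)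
    have b1 := neg_abs_le (g b)
    have b2 := le_abs_self (g b)
    split_ifs <;> linarith
  have := mul_le_mul_of_nonneg_left ((add_le_add k₁ k₂).trans hb) hlam.le
  linarith

namespace ViscousProfile

variable {f : ℝ → ℝ → ℝ} {fl fr : ℝ → ℝ} {L c lam ε : ℝ} {w u F : ℝ → ℝ}

/-- Both `w` and `u` lie in `[0, 1]`, so `lam F' = w - u` makes `lam F` 1-Lipschitz, whatever `ε`
is. -/
theorem abs_flux_sub_le (hf : JumpFlux f fl fr L c) (hlam : 0 < lam) (hε : 0 < ε)
    (h : ViscousProfile f lam ε w u F) (hw : ∀ᵐ x, 0 ≤ w x ∧ w x ≤ 1) (x y : ℝ) :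
    lam * |F y - F x| ≤ |y - x| := by
  have h0 := h.nonneg hf hlam hε (hw.mono fun x hx => hx.1)
  have h1 := h.le_one hf hlam hε (hw.mono fun x hx => hx.2)
  have : ‖∫ t in x..y, (w t - u t) / lam‖ ≤ 1 / lam * |y - x| := by
    refine intervalIntegral.norm_integral_le_of_norm_le_const_ae ?_
    filter_upwards [hw] with t ht _
    rw [norm_div, Real.norm_of_nonneg hlam.le, Real.norm_eq_abs]
    exact div_le_div_of_nonneg_right (abs_le.2 ⟨by linarith [h1 t], by linarith [h0 t]⟩) hlam.le
  rw [h.flux.sub_eq, ← Real.norm_eq_abs]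
  calc _ ≤ lam * (1 / lam * |y - x|) := mul_le_mul_of_nonneg_left this hlam.le
    _ = |y - x| := by field_simp

/-- A translate solves the same system as long as `x` and `x + s` stay on one side of the interface.
The term `2 * s` bounds the flux increments at the two end points. -/
theorem integral_abs_translate_interval_le (hf : JumpFlux f fl fr L c) (hlam : 0 < lam)
    (hε : 0 < ε) (h : ViscousProfile f lam ε w u F) (hw : ∀ᵐ x, 0 ≤ w x ∧ w x ≤ 1) {s a b : ℝ}
    (hs : 0 ≤ s) (hab : a ≤ b) (hside : 0 ≤ a ∨ b + s ≤ 0) :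
    ∫ x in a..b, |u (x + s) - u x| ≤ (∫ x in a..b, |w (x + s) - w x|) + 2 * s := by
  have hg : IsPrimitive (fun x => -(F (x + s) - F x))
      fun x => ((u (x + s) - u x) - (w (x + s) - w x)) / lam := by
    have := ((h.flux.comp_add_right s).sub h.flux).neg
    refine ⟨this.locallyIntegrable.congr (Eventually.of_forall fun x => ?_), fun x y => ?_⟩
    · ring
    · rw [this.sub_eq]
      refine intervalIntegral.integral_congr fun t _ => ?_
      ring
  have hk : IntervalIntegrable (fun x => w (x + s) - w x) volume a b :=
    ((h.integrable_data.comp_add_right s).sub h.integrable_data).intervalIntegrable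
  have key := IsPrimitive.kato_abs hab hε hlam ((h.state.comp_add_right s).sub h.state) hg hk
    (L := L) fun x hx => by
    have e : ε * ((f (x + s) (u (x + s)) - F (x + s)) / ε - (f x (u x) - F x) / ε) -
        -(F (x + s) - F x) = f (x + s) (u (x + s)) - f x (u x) := by
      field_simp
      ring
    have e2 : f (x + s) (u (x + s)) = f x (u (x + s)) := by
      rw [hf.eq_ite, hf.eq_ite x]
      rcases hside with h0 | h0
      · rw [if_neg (by linarith [hx.1]), if_neg (by linarith [hx.1])]
      · rw [if_pos (by linarith [hx.2]), if_pos (by linarith [hx.2])]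
    rw [e, e2]
    exact hf.lipschitz _ _ _
  refine key.trans (add_le_add_right ?_ _)
  rw [abs_neg, abs_neg]
  have h1 := h.abs_flux_sub_le hf hlam hε hw a (a + s)
  have h2 := h.abs_flux_sub_le hf hlam hε hw b (b + s)
  rw [add_sub_cancel_left, abs_of_nonneg hs] at h1 h2
  linarith

/-- The constant 5 collects `2 s` from each side of the interface and `s` from the strip `[-s, 0]`,
where the translation crosses the jump and only `0 ≤ u ≤ 1` is used. -/
theorem integral_abs_translate_le (hf : JumpFlux f fl fr L c) (hlam : 0 < lam)
    (hε : 0 < ε) (h : ViscousProfile f lam ε w u F) (hw : ∀ᵐ x, 0 ≤ w x ∧ w x ≤ 1) {s : ℝ}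
    (hs : 0 ≤ s) : ∫ x, |u (x + s) - u x| ≤ (∫ x, |w (x + s) - w x|) + 5 * s := by
  have h0 := h.nonneg hf hlam hε (hw.mono fun x hx => hx.1)
  have h1 := h.le_one hf hlam hε (hw.mono fun x hx => hx.2)
  have hiu : Integrable fun x => |u (x + s) - u x| :=
    ((h.integrable.comp_add_right s).sub h.integrable).abs
  have hiw : Integrable fun x => |w (x + s) - w x| :=
    ((h.integrable_data.comp_add_right s).sub h.integrable_data).abs
  have hlim := intervalIntegral_tendsto_integral hiu tendsto_neg_atTop_atBot tendsto_id
  refine le_of_tendsto hlim ?_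
  filter_upwards [eventually_ge_atTop s] with R hR
  have k₁ := h.integral_abs_translate_interval_le hf hlam hε hw (a := -R) (b := -s) hs
    (by linarith) (Or.inr (by simp))
  have k₂ := h.integral_abs_translate_interval_le hf hlam hε hw (a := 0) (b := R) hs
    (by linarith) (Or.inl le_rfl)
  have k₃ : ∫ x in (-s)..0, |u (x + s) - u x| ≤ s := by
    have : ∫ x in (-s)..0, |u (x + s) - u x| ≤ ∫ x in (-s)..0, (1 : ℝ) :=
      intervalIntegral.integral_mono_on (by linarith) hiu.intervalIntegrable
        (continuous_const.intervalIntegrable _ _) fun x _ =>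
          abs_le.2 ⟨by linarith [h0 (x + s), h1 x], by linarith [h1 (x + s), h0 x]⟩
    simpa using this
  have k₄ : 0 ≤ ∫ x in (-s)..0, |w (x + s) - w x| :=
    intervalIntegral.integral_nonneg (by linarith) fun x _ => abs_nonneg _
  have e₁ := intervalIntegral.integral_add_adjacent_intervals
    (hiu.intervalIntegrable (a := -R) (b := -s)) (hiu.intervalIntegrable (b := R))
  have e₂ := intervalIntegral.integral_add_adjacent_intervals
    (hiu.intervalIntegrable (a := -s) (b := 0)) (hiu.intervalIntegrable (b := R))
  have e₃ := intervalIntegral.integral_add_adjacent_intervals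
    (hiw.intervalIntegrable (a := -R) (b := -s)) (hiw.intervalIntegrable (b := R))
  have e₄ := intervalIntegral.integral_add_adjacent_intervals
    (hiw.intervalIntegrable (a := -s) (b := 0)) (hiw.intervalIntegrable (b := R))
  have k₅ : ∫ x in (-R)..R, |w (x + s) - w x| ≤ ∫ x, |w (x + s) - w x| := by
    rw [intervalIntegral.integral_of_le (by linarith)]
    exact setIntegral_le_integral hiw (Eventually.of_forall fun x => abs_nonneg _)
  simp only [id]
  linarith

/-- Conservation of mass. -/
theorem integral_eq (hlam : 0 < lam) (h : ViscousProfile f lam ε w u F) :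
    ∫ x, u x = ∫ x, w x := by
  have hi : Integrable fun x => (w x - u x) / lam := (h.integrable_data.sub h.integrable).div_const _
  have hlim := intervalIntegral_tendsto_integral hi tendsto_neg_atTop_atBot tendsto_id
  simp_rw [← h.flux.sub_eq] at hlim
  have := tendsto_nhds_unique hlim
    (h.tendsto_top.sub (h.tendsto_bot.comp tendsto_neg_atTop_atBot))
  rw [integral_div, integral_sub h.integrable_data h.integrable, sub_zero, div_eq_zero_iff] at this
  rcases this with h | h <;> linarith

/-- Integrating `F = f(x, u) - ε u'` gives a bound that does not grow with `b - a`: the first term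
is controlled by the mass, the second by the oscillation of `u`, at most one. -/
theorem abs_integral_flux_le (hf : JumpFlux f fl fr L c) (hlam : 0 < lam) (hε : 0 < ε)
    (h : ViscousProfile f lam ε w u F) (hw : ∀ᵐ x, 0 ≤ w x ∧ w x ≤ 1) {a b : ℝ} (hab : a ≤ b) :
    |∫ x in a..b, F x| ≤ L * (∫ x, w x) + ε := by
  have h0 := h.nonneg hf hlam hε (hw.mono fun x hx => hx.1)
  have h1 := h.le_one hf hlam hε (hw.mono fun x hx => hx.2)
  have hfu := hf.integrable h.integrable
  have e := h.state.sub_eq a b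
  rw [intervalIntegral.integral_div, intervalIntegral.integral_sub hfu.intervalIntegrable
    (h.continuous_flux.intervalIntegrable _ _), eq_div_iff hε.ne'] at e
  have e2 : |∫ x in a..b, f x (u x)| ≤ L * ∫ x, w x := by
    rw [← h.integral_eq hlam, ← integral_const_mul, ← Real.norm_eq_abs]
    calc _ ≤ ∫ x in a..b, ‖f x (u x)‖ := intervalIntegral.norm_integral_le_integral_norm hab
      _ ≤ ∫ x, ‖f x (u x)‖ := by
        rw [intervalIntegral.integral_of_le hab]
        exact setIntegral_le_integral hfu.norm (Eventually.of_forall fun x => norm_nonneg _)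
      _ ≤ _ := integral_mono hfu.norm (h.integrable.const_mul L) fun x => by
        have := hf.abs_le x (u x)
        rwa [abs_of_nonneg (h0 x)] at this
  have e3 : |(u b - u a) * ε| ≤ ε := by
    rw [abs_mul, abs_of_pos hε]
    exact mul_le_of_le_one_left hε.le
      (abs_le.2 ⟨by linarith [h0 b, h1 a], by linarith [h1 b, h0 a]⟩)
  have e4 : ∫ x in a..b, F x = (∫ x in a..b, f x (u x)) - (u b - u a) * ε := by linarith
  rw [e4]
  exact (abs_sub _ _).trans (add_le_add e2 e3)

/-- Mass balance on `[-r, r]` bounds the tail of `u` by the tail of `w` plus `lam (F r - F (-r))`.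
Averaging over `r` in `[R, 2R]` replaces the fluxes by their integrals divided by `R`. -/
theorem tail_le (hf : JumpFlux f fl fr L c) (hlam : 0 < lam) (hε : 0 < ε)
    (h : ViscousProfile f lam ε w u F) (hw : ∀ᵐ x, 0 ≤ w x ∧ w x ≤ 1) {R : ℝ} (hR : 0 < R) :
    (∫ x, u x) - ∫ x in (-(2 * R))..2 * R, u x ≤
      (∫ x, w x) - (∫ x in (-R)..R, w x) + 2 * lam * (L * (∫ x, w x) + ε) / R := by
  have h0 := h.nonneg hf hlam hε (hw.mono fun x hx => hx.1)
  have hu := h.integrable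
  have hwi := h.integrable_data
  set A := (∫ x, u x) - ∫ x in (-(2 * R))..2 * R, u x with hA
  set B := (∫ x, w x) - (∫ x in (-R)..R, w x) with hB
  have hpt : ∀ r ∈ Set.Icc R (2 * R), A ≤ B + lam * (F r - F (-r)) := by
    intro r hr
    have i1 : ∫ x in (-r)..r, u x ≤ ∫ x in (-(2 * R))..2 * R, u x := by
      refine intervalIntegral.integral_mono_interval ?_ ?_ hr.2
        (Eventually.of_forall h0) hu.intervalIntegrable <;> linarith [hr.1, hr.2]
    have i2 : ∫ x in (-R)..R, w x ≤ ∫ x in (-r)..r, w x := by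
      refine intervalIntegral.integral_mono_interval ?_ ?_ hr.1
        (ae_restrict_of_ae (hw.mono fun x hx => hx.1)) hwi.intervalIntegrable <;>
        linarith [hr.1, hr.2]
    have i3 := h.flux.sub_eq (-r) r
    rw [intervalIntegral.integral_div, intervalIntegral.integral_sub hwi.intervalIntegrable
      hu.intervalIntegrable] at i3
    rw [i3, mul_div_cancel₀ _ hlam.ne', hA, hB, h.integral_eq hlam]
    linarith
  have hc1 : Continuous fun r => F r - F (-r) :=
    h.continuous_flux.sub (h.continuous_flux.comp continuous_neg)
  have hint : ∫ r in R..2 * R, A ≤ ∫ r in R..2 * R, (B + lam * (F r - F (-r))) :=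
    intervalIntegral.integral_mono_on (by linarith) (continuous_const.intervalIntegrable _ _)
      ((continuous_const.add (continuous_const.mul hc1)).intervalIntegrable _ _) hpt
  have hc2 : IntervalIntegrable (fun r => lam * (F r - F (-r))) volume R (2 * R) :=
    (continuous_const.mul hc1).intervalIntegrable _ _
  have hc3 : IntervalIntegrable (fun r => F (-r)) volume R (2 * R) :=
    (h.continuous_flux.comp continuous_neg).intervalIntegrable _ _
  rw [intervalIntegral.integral_add (continuous_const.intervalIntegrable _ _) hc2, intervalIntegral.integral_const_mul,
    intervalIntegral.integral_sub (h.continuous_flux.intervalIntegrable _ _) hc3,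
    intervalIntegral.integral_comp_neg (fun x => F x), intervalIntegral.integral_const,
    intervalIntegral.integral_const, smul_eq_mul, smul_eq_mul] at hint
  have j1 := (abs_le.1 (h.abs_integral_flux_le hf hlam hε hw (show R ≤ 2 * R by linarith))).2
  have j2 := (abs_le.1 (h.abs_integral_flux_le hf hlam hε hw (show -(2 * R) ≤ -R by linarith))).1
  have j3 : (2 * R - R) * A ≤ (2 * R - R) * B + lam * (2 * (L * (∫ x, w x) + ε)) := by
    refine hint.trans (add_le_add_right (mul_le_mul_of_nonneg_left ?_ hlam.le) _)
    linarith
  rw [← sub_le_iff_le_add', le_div_iff₀ hR]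
  linarith

end ViscousProfile

/-! ### Compactness in L¹ -/

/-- The window mean minus `u` is the mean over `t` of `u (x + t) - u x`; Tonelli's theorem then puts
the integral in `x` inside. -/
theorem integral_abs_average_sub_le {u : ℝ → ℝ} (hu : Continuous u) (hi : Integrable u)
    {s η : ℝ} (hs : 0 < s) (hη : 0 ≤ η)
    (h : ∀ t ∈ Set.Icc 0 s, ∫ x, |u (x + t) - u x| ≤ η) :
    Integrable (fun x => (∫ t in x..x + s, u t) / s - u x) ∧
      ∫ x, |(∫ t in x..x + s, u t) / s - u x| ≤ η := by
  have hcont : Continuous fun x => (∫ t in x..x + s, u t) / s - u x := by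
    have h1 : Continuous fun x => ∫ t in (0 : ℝ)..x, u t :=
      intervalIntegral.continuous_primitive (fun a b => hu.intervalIntegrable a b) 0
    have h2 : (fun x => ∫ t in x..x + s, u t) =
        fun x => (∫ t in (0 : ℝ)..x + s, u t) - ∫ t in (0 : ℝ)..x, u t := by
      funext x
      rw [intervalIntegral.integral_interval_sub_left (hu.intervalIntegrable _ _)
        (hu.intervalIntegrable _ _)]
    have h3 : Continuous fun x => ∫ t in x..x + s, u t := by
      rw [h2]
      exact (h1.comp (continuous_add_const s)).sub h1
    exact (h3.div_const s).sub hu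
  have hpt : ∀ x, ‖(∫ t in x..x + s, u t) / s - u x‖ₑ ≤
      ENNReal.ofReal (1 / s) * ∫⁻ t in Set.Ioc 0 s, ‖u (x + t) - u x‖ₑ := by
    intro x
    have e : (∫ t in x..x + s, u t) / s - u x = 1 / s * ∫ t in (0 : ℝ)..s, (u (x + t) - u x) := by
      have hsh : Continuous fun t => u (x + t) := by fun_prop
      rw [intervalIntegral.integral_sub (hsh.intervalIntegrable _ _) (continuous_const.intervalIntegrable _ _),
        intervalIntegral.integral_comp_add_left (fun t => u t), intervalIntegral.integral_const]
      simp only [add_zero, sub_zero, smul_eq_mul]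
      field_simp
    rw [e, enorm_mul, Real.enorm_of_nonneg (by positivity), intervalIntegral.integral_of_le hs.le]
    gcongr
    exact enorm_integral_le_lintegral_enorm _
  have hl : ∫⁻ x, ‖(∫ t in x..x + s, u t) / s - u x‖ₑ ≤ ENNReal.ofReal η := by
    calc _ ≤ ∫⁻ x, ENNReal.ofReal (1 / s) * ∫⁻ t in Set.Ioc 0 s, ‖u (x + t) - u x‖ₑ :=
          lintegral_mono hpt
      _ = ENNReal.ofReal (1 / s) * ∫⁻ x, ∫⁻ t in Set.Ioc 0 s, ‖u (x + t) - u x‖ₑ :=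
          lintegral_const_mul' _ _ ENNReal.ofReal_ne_top
      _ = ENNReal.ofReal (1 / s) * ∫⁻ t in Set.Ioc 0 s, ∫⁻ x, ‖u (x + t) - u x‖ₑ := by
          rw [lintegral_lintegral_swap]
          refine Continuous.aemeasurable ?_
          unfold Function.uncurry
          fun_prop
      _ ≤ ENNReal.ofReal (1 / s) * ∫⁻ t in Set.Ioc 0 s, ENNReal.ofReal η := by
          gcongr ENNReal.ofReal (1 / s) * ?_
          refine setLIntegral_mono measurable_const fun t ht => ?_
          have hit : Integrable fun x => u (x + t) - u x := (hi.comp_add_right t).sub hi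
          rw [← ofReal_integral_norm_eq_lintegral_enorm hit]
          exact ENNReal.ofReal_le_ofReal (h t (Set.Ioc_subset_Icc_self ht))
      _ = ENNReal.ofReal η := by
          rw [setLIntegral_const, Real.volume_Ioc, sub_zero, mul_comm (ENNReal.ofReal η),
            ← mul_assoc, ← ENNReal.ofReal_mul (by positivity), one_div,
            inv_mul_cancel₀ hs.ne', ENNReal.ofReal_one, one_mul]
  have hint : Integrable fun x => (∫ t in x..x + s, u t) / s - u x :=
    ⟨hcont.aestronglyMeasurable, hl.trans_lt ENNReal.ofReal_lt_top⟩
  refine ⟨hint, ?_⟩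
  have := integral_norm_eq_lintegral_enorm hint.aestronglyMeasurable
  simp only [Real.norm_eq_abs] at this
  rw [this]
  exact ENNReal.toReal_le_of_le_ofReal hη hl

/-- Tychonoff's theorem gives convergence at the rationals, and the common Lipschitz bound extends
it to every real point. -/
theorem exists_subseq_tendsto_of_lipschitz {V : ℕ → ℝ → ℝ} (h0 : ∀ n, V n 0 = 0)
    (hV : ∀ n x y, |V n x - V n y| ≤ |x - y|) :
    ∃ (φ : ℕ → ℕ) (W : ℝ → ℝ), StrictMono φ ∧ ∀ x, Tendsto (fun n => V (φ n) x) atTop (𝓝 (W x)) := by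
  have hK : IsCompact (Set.univ.pi fun q : ℚ => Set.Icc (-|(q : ℝ)|) |(q : ℝ)|) :=
    isCompact_univ_pi fun _ => isCompact_Icc
  obtain ⟨a, -, φ, hφ, ha⟩ := hK.tendsto_subseq (x := fun n (q : ℚ) => V n q) fun n q _ => by
    have := hV n q 0
    rw [h0, sub_zero, sub_zero] at this
    exact abs_le.1 this
  rw [tendsto_pi_nhds] at ha
  have hcauchy : ∀ x, CauchySeq fun n => V (φ n) x := by
    intro x
    rw [Metric.cauchySeq_iff']
    intro η hη
    obtain ⟨q, hq1, hq2⟩ := exists_rat_btwn (show x < x + η / 4 by linarith)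
    have hq : |x - q| ≤ η / 4 := abs_le.2 ⟨by linarith, by linarith⟩
    obtain ⟨N, hN⟩ := Metric.cauchySeq_iff'.1 (ha q).cauchySeq (η / 2) (half_pos hη)
    refine ⟨N, fun n hn => ?_⟩
    have h1 := hN n hn
    have h2 := hV (φ n) x q
    have h3 := hV (φ N) x q
    simp only [Function.comp, Real.dist_eq] at h1 ⊢
    rw [abs_lt] at h1 ⊢
    rw [abs_le] at h2 h3
    constructor <;> linarith
  choose W hW using fun x => cauchySeq_tendsto_of_complete (hcauchy x)
  exact ⟨φ, W, hφ, hW⟩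

/-- A compactness criterion of Kolmogorov–Riesz type. -/
theorem exists_subseq_cauchy {u : ℕ → ℝ → ℝ} (hc : ∀ n, Continuous (u n))
    (hi : ∀ n, Integrable (u n)) (h0 : ∀ n x, 0 ≤ u n x) (h1 : ∀ n x, u n x ≤ 1)
    (equi : ∀ η > 0, ∃ δ > 0, ∀ n, ∀ t ∈ Set.Icc 0 δ, ∫ x, |u n (x + t) - u n x| ≤ η)
    (tight : ∀ η > 0, ∃ R > 0, ∀ n, (∫ x, u n x) - ∫ x in (-R)..R, u n x ≤ η) :
    ∃ φ : ℕ → ℕ, StrictMono φ ∧ ∀ η > 0, ∃ N, ∀ m ≥ N, ∀ n ≥ N,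
      ∫ x, |u (φ m) x - u (φ n) x| ≤ η := by
  set V : ℕ → ℝ → ℝ := fun n x => ∫ t in (0 : ℝ)..x, u n t with hVdef
  have hsub : ∀ n x y, V n x - V n y = ∫ t in y..x, u n t := fun n x y =>
    intervalIntegral.integral_interval_sub_left ((hc n).intervalIntegrable _ _)
      ((hc n).intervalIntegrable _ _)
  have hV : ∀ n x y, |V n x - V n y| ≤ |x - y| := fun n x y => by
    rw [hsub, ← Real.norm_eq_abs, ← one_mul |x - y|]
    exact intervalIntegral.norm_integral_le_of_norm_le_const fun t _ => by
      rw [Real.norm_of_nonneg (h0 n t)]; exact h1 n t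
  obtain ⟨φ, W, hφ, hW⟩ := exists_subseq_tendsto_of_lipschitz (V := V) (by simp [hVdef]) hV
  refine ⟨φ, hφ, fun η hη => ?_⟩
  obtain ⟨s, hs, hs'⟩ := equi (η / 8) (by positivity)
  obtain ⟨R, hR, hR'⟩ := tight (η / 8) (by positivity)
  -- `D n` is the mean of `u n` over `[x, x + s]`. It is bounded by 1 and converges pointwise along
  -- `φ`, so dominated convergence applies on `[-R, R]`, while equicontinuity keeps it close to `u
  -- n`.
  set D : ℕ → ℝ → ℝ := fun n x => (V n (x + s) - V n x) / s with hD
  set E : ℝ → ℝ := fun x => (W (x + s) - W x) / s with hE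
  have hDc : ∀ n, Continuous (D n) := fun n => by
    have : Continuous (V n) :=
      intervalIntegral.continuous_primitive (fun a b => (hc n).intervalIntegrable a b) 0
    exact ((this.comp (continuous_add_const s)).sub this).div_const s
  have hDE : ∀ x, Tendsto (fun n => D (φ n) x) atTop (𝓝 (E x)) := fun x =>
    ((hW (x + s)).sub (hW x)).div_const s
  have hD1 : ∀ n x, |D n x| ≤ 1 := fun n x => by
    rw [hD, abs_div, abs_of_pos hs, div_le_one hs]
    have := hV n (x + s) x
    rwa [add_sub_cancel_left, abs_of_pos hs] at this
  have hE1 : ∀ x, |E x| ≤ 1 := fun x =>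
    le_of_tendsto (hDE x).abs (Eventually.of_forall fun n => hD1 _ x)
  have hEm : AEStronglyMeasurable E volume :=
    aestronglyMeasurable_of_tendsto_ae atTop (fun n => (hDc (φ n)).aestronglyMeasurable)
      (Eventually.of_forall hDE)
  have hEi : ∀ a b, IntervalIntegrable E volume a b := fun a b =>
    (intervalIntegrable_const (c := (1 : ℝ))).mono_fun hEm.restrict
      (Eventually.of_forall fun x => by simpa using hE1 x)
  have hlim : Tendsto (fun n => ∫ x in (-R)..R, |D (φ n) x - E x|) atTop (𝓝 0) := by
    have : Tendsto (fun n => ∫ x in (-R)..R, |D (φ n) x - E x|) atTop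
        (𝓝 (∫ x in (-R)..R, (0 : ℝ))) := by
      refine intervalIntegral.tendsto_integral_filter_of_dominated_convergence (fun _ => 2)
        ?_ ?_ intervalIntegrable_const ?_
      · exact Eventually.of_forall fun n =>
          ((hDc _).aestronglyMeasurable.sub hEm).norm.restrict
      · refine Eventually.of_forall fun n => Eventually.of_forall fun x _ => ?_
        rw [Real.norm_eq_abs, abs_abs]
        linarith [abs_sub (D (φ n) x) (E x), hD1 (φ n) x, hE1 x]
      · refine Eventually.of_forall fun x _ => ?_
        simpa using ((hDE x).sub_const (E x)).abs
    simpa using this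
  obtain ⟨N, hN⟩ := eventually_atTop.1 (hlim.eventually (gt_mem_nhds (show 0 < η / 8 by positivity)))
  refine ⟨N, fun m hm n hn => ?_⟩
  have hav : ∀ n, IntervalIntegrable (fun x => |D n x - u n x|) volume (-R) R ∧
      ∫ x in (-R)..R, |D n x - u n x| ≤ η / 8 := by
    intro n
    have e : D n = fun x => (∫ t in x..x + s, u n t) / s := by
      funext x; rw [← hsub]
    rw [e]
    obtain ⟨k1, k2⟩ := integral_abs_average_sub_le (hc n) (hi n) hs (by positivity) (hs' n)
    refine ⟨k1.abs.intervalIntegrable, le_trans ?_ k2⟩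
    rw [intervalIntegral.integral_of_le (by linarith)]
    exact setIntegral_le_integral k1.abs (Eventually.of_forall fun x => abs_nonneg _)
  have hDEi : ∀ n, IntervalIntegrable (fun x => |D n x - E x|) volume (-R) R := fun n =>
    (((hDc n).intervalIntegrable _ _).sub (hEi _ _)).abs
  have hmn : Integrable fun x => |u (φ m) x - u (φ n) x| := ((hi _).sub (hi _)).abs
  -- The path from `u (φ m)` to `u (φ n)` through `D (φ m)`, `E` and `D (φ n)` costs four times `η /
  -- 8`.
  have hcore : ∫ x in (-R)..R, |u (φ m) x - u (φ n) x| ≤ η / 2 := by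
    have i1 := (hav (φ m)).1.add (hDEi (φ m))
    have i2 := (hDEi (φ n)).add (hav (φ n)).1
    have := intervalIntegral.integral_mono_on (by linarith) hmn.intervalIntegrable (i1.add i2)
      fun x _ => by
      have a1 := abs_sub_le (u (φ m) x) (D (φ m) x) (u (φ n) x)
      have a2 := abs_sub_le (D (φ m) x) (E x) (u (φ n) x)
      have a3 := abs_sub_le (E x) (D (φ n) x) (u (φ n) x)
      rw [abs_sub_comm (u (φ m) x) (D (φ m) x)] at a1
      rw [abs_sub_comm (E x) (D (φ n) x)] at a3
      show |u (φ m) x - u (φ n) x| ≤ (|D (φ m) x - u (φ m) x| + |D (φ m) x - E x|) +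
        (|D (φ n) x - E x| + |D (φ n) x - u (φ n) x|)
      linarith
    rw [intervalIntegral.integral_add i1 i2,
      intervalIntegral.integral_add (hav (φ m)).1 (hDEi (φ m)),
      intervalIntegral.integral_add (hDEi (φ n)) (hav (φ n)).1] at this
    linarith [(hav (φ m)).2, (hav (φ n)).2, hN m hm, hN n hn]
  have hs : Integrable fun x => u (φ m) x + u (φ n) x := (hi _).add (hi _)
  -- Outside `[-R, R]`, nonnegativity gives `|u_m - u_n| ≤ u_m + u_n`, so tightness bounds that part
  -- by `η / 4`.
  have htail : ∫ x in (-R)..R, ((u (φ m) x + u (φ n) x) - |u (φ m) x - u (φ n) x|) ≤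
      ∫ x, ((u (φ m) x + u (φ n) x) - |u (φ m) x - u (φ n) x|) := by
    rw [intervalIntegral.integral_of_le (by linarith)]
    refine setIntegral_le_integral (hs.sub hmn) (Eventually.of_forall fun x => ?_)
    have : |u (φ m) x - u (φ n) x| ≤ u (φ m) x + u (φ n) x :=
      abs_le.2 ⟨by linarith [h0 (φ m) x], by linarith [h0 (φ n) x]⟩
    simpa using this
  rw [intervalIntegral.integral_sub hs.intervalIntegrable hmn.intervalIntegrable,
    integral_sub hs hmn, integral_add (hi _) (hi _), intervalIntegral.integral_add
    (hi _).intervalIntegrable (hi _).intervalIntegrable] at htail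
  linarith [hR' (φ m), hR' (φ n)]

/-! ### Ordering of viscous layers -/

theorem hasDerivWithinAt_rescale {u : ℝ → ℝ} {x₀ ε y u' : ℝ} (hε : 0 < ε)
    (h : HasDerivWithinAt u (u' / ε) (Set.Ici (x₀ + ε * y)) (x₀ + ε * y)) :
    HasDerivWithinAt (fun y => u (x₀ + ε * y)) u' (Set.Ici y) y := by
  have h1 : HasDerivWithinAt (fun y : ℝ => x₀ + ε * y) (ε * 1) (Set.Ici y) y :=
    (((hasDerivAt_id y).const_mul ε).const_add x₀).hasDerivWithinAt
  have h2 := h.comp y h1 fun z hz => by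
    simp only [Set.mem_Ici] at hz ⊢
    nlinarith
  refine h2.congr_deriv ?_
  field_simp

/-- Two viscous layers, with different viscosities, whose total fluxes are ordered can cross in one
direction only. -/
theorem lt_of_viscous_layers {φ u v Fu Fv : ℝ → ℝ} {x₀ x₁ ε ε' α β : ℝ} (hx : x₀ < x₁)
    (hε : 0 < ε) (hε' : 0 < ε') (hu : Continuous u) (hv : Continuous v)
    (hu' : ∀ x ∈ Set.Ico x₀ x₁, HasDerivWithinAt u ((φ (u x) - Fu x) / ε) (Set.Ici x) x)
    (hv' : ∀ x ∈ Set.Ico x₀ x₁, HasDerivWithinAt v ((φ (v x) - Fv x) / ε') (Set.Ici x) x)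
    (hFu : ∀ x ∈ Set.Ico x₀ x₁, Fu x ≤ α) (hFv : ∀ x ∈ Set.Ico x₀ x₁, β ≤ Fv x) (hαβ : α < β)
    (hend : u x₁ < v x₁) (hφu : φ (u x₁) < β) (hφv : α < φ (v x₁)) : u x₀ < v x₀ := by
  by_contra! hcon
  -- Rescaling each layer by its own viscosity gives unit-viscosity equations with the same `φ`. The
  -- price is that `x₁` corresponds to two different times `S` and `T`.
  set U : ℝ → ℝ := fun y => u (x₀ + ε * y) with hU
  set V : ℝ → ℝ := fun y => v (x₀ + ε' * y) with hV
  set S := (x₁ - x₀) / ε with hS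
  set T := (x₁ - x₀) / ε' with hT
  have hUS : U S = u x₁ := by simp only [hU, hS]; congr 1; field_simp; ring
  have hVT : V T = v x₁ := by simp only [hV, hT]; congr 1; field_simp; ring
  have hS0 : 0 < S := div_pos (sub_pos.2 hx) hε
  have hT0 : 0 < T := div_pos (sub_pos.2 hx) hε'
  have hUc : Continuous U := hu.comp (by fun_prop)
  have hVc : Continuous V := hv.comp (by fun_prop)
  have memS : ∀ y, 0 ≤ y → y < S → x₀ + ε * y ∈ Set.Ico x₀ x₁ := fun y h0 h1 => by
    rw [hS, lt_div_iff₀ hε] at h1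
    exact ⟨by nlinarith, by linarith⟩
  have memT : ∀ y, 0 ≤ y → y < T → x₀ + ε' * y ∈ Set.Ico x₀ x₁ := fun y h0 h1 => by
    rw [hT, lt_div_iff₀ hε'] at h1
    exact ⟨by nlinarith, by linarith⟩
  have hU' : ∀ y, 0 ≤ y → y < S →
      HasDerivWithinAt U (φ (U y) - Fu (x₀ + ε * y)) (Set.Ici y) y := fun y h0 h1 =>
    hasDerivWithinAt_rescale hε (hu' _ (memS y h0 h1))
  have hV' : ∀ y, 0 ≤ y → y < T →
      HasDerivWithinAt V (φ (V y) - Fv (x₀ + ε' * y)) (Set.Ici y) y := fun y h0 h1 =>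
    hasDerivWithinAt_rescale hε' (hv' _ (memT y h0 h1))
  -- At a contact the `φ` terms cancel and `V' - U' = Fu - Fv ≤ α - β < 0`, so `V` cannot overtake
  -- `U`.
  have hcmp : ∀ y ∈ Set.Icc 0 (min S T), V y ≤ U y :=
    image_le_of_deriv_right_lt_deriv_boundary' hVc.continuousOn
      (fun y hy => hV' y hy.1 (hy.2.trans_le (min_le_right _ _)))
      (by simpa [hU, hV] using hcon) hUc.continuousOn
      (fun y hy => hU' y hy.1 (hy.2.trans_le (min_le_left _ _))) fun y hy heq => by
        have h1 := hFu _ (memS y hy.1 (hy.2.trans_le (min_le_left _ _)))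
        have h2 := hFv _ (memT y hy.1 (hy.2.trans_le (min_le_right _ _)))
        rw [heq]
        linarith
  -- Beyond the shorter time, the layer that has reached `x₁` is replaced by its end value. This
  -- constant is a barrier for the other layer, by `φ (u x₁) < β` if `S ≤ T` and by `α < φ (v x₁)`
  -- otherwise. Either way `v x₁ ≤ u x₁`, against `hend`.
  rcases le_total S T with hST | hST
  · rw [min_eq_left hST] at hcmp
    have h1 := image_le_of_deriv_right_lt_deriv_boundary' (f := V) (B := fun _ => U S)
      (B' := fun _ => 0) (a := S) (b := T) hVc.continuousOn
      (fun y hy => hV' y (hS0.le.trans hy.1) hy.2) (hcmp S ⟨hS0.le, le_rfl⟩) continuousOn_const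
      (fun y _ => hasDerivWithinAt_const _ _ _) (fun y hy heq => by
        have h2 := hFv _ (memT y (hS0.le.trans hy.1) hy.2)
        rw [heq, hUS]
        linarith) ⟨hST, le_rfl⟩
    rw [hVT, hUS] at h1
    linarith
  · rw [min_eq_right hST] at hcmp
    have h1 := image_le_of_deriv_right_lt_deriv_boundary' (f := fun _ => V T) (B := U)
      (f' := fun _ => 0) (a := T) (b := S) continuousOn_const
      (fun y _ => hasDerivWithinAt_const _ _ _) (hcmp T ⟨hT0.le, le_rfl⟩) hUc.continuousOn
      (fun y hy => hU' y (hT0.le.trans hy.1) hy.2) (fun y hy heq => by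
        have h2 := hFu _ (memS y (hT0.le.trans hy.1) hy.2)
        rw [← heq, hVT]
        linarith) ⟨hST, le_rfl⟩
    rw [hVT, hUS] at h1
    linarith

/-- The mirror image of `lt_of_viscous_layers`. -/
theorem lt_of_viscous_layers_left {φ u v Fu Fv : ℝ → ℝ} {x₀ x₁ ε ε' α β : ℝ} (hx : x₁ < x₀)
    (hε : 0 < ε) (hε' : 0 < ε') (hu : Continuous u) (hv : Continuous v)
    (hu' : ∀ x ∈ Set.Ioc x₁ x₀, HasDerivWithinAt u ((φ (u x) - Fu x) / ε) (Set.Iic x) x)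
    (hv' : ∀ x ∈ Set.Ioc x₁ x₀, HasDerivWithinAt v ((φ (v x) - Fv x) / ε') (Set.Iic x) x)
    (hFu : ∀ x ∈ Set.Ioc x₁ x₀, Fu x ≤ α) (hFv : ∀ x ∈ Set.Ioc x₁ x₀, β ≤ Fv x) (hαβ : α < β)
    (hend : v x₁ < u x₁) (hφu : φ (u x₁) < β) (hφv : α < φ (v x₁)) : v x₀ < u x₀ := by
  have hmem : ∀ x ∈ Set.Ico (-x₀) (-x₁), -x ∈ Set.Ioc x₁ x₀ := fun x hx =>
    ⟨by linarith [hx.2], by linarith [hx.1]⟩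
  have hder : ∀ {g : ℝ → ℝ} {g' x : ℝ}, HasDerivWithinAt g g' (Set.Iic (-x)) (-x) →
      HasDerivWithinAt (fun x => g (-x)) (-g') (Set.Ici x) x := by
    intro g g' x h
    have h2 := h.comp x (hasDerivAt_neg x).hasDerivWithinAt fun z (hz : x ≤ z) => by
      simpa using hz
    exact h2.congr_deriv (by ring)
  -- The reflection `x ↦ -x` changes the sign of `φ` and of the fluxes, so `u` and `v` exchange
  -- roles and `α`, `β` become `-β`, `-α`.
  have := lt_of_viscous_layers (φ := fun s => -φ s) (u := fun x => v (-x)) (v := fun x => u (-x))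
    (Fu := fun x => -Fv (-x)) (Fv := fun x => -Fu (-x)) (x₀ := -x₀) (x₁ := -x₁) (ε := ε')
    (ε' := ε) (α := -β) (β := -α) (by linarith) hε' hε (hv.comp continuous_neg)
    (hu.comp continuous_neg)
    (fun x hx => (hder (hv' _ (hmem x hx))).congr_deriv (by ring))
    (fun x hx => (hder (hu' _ (hmem x hx))).congr_deriv (by ring))
    (fun x hx => neg_le_neg (hFv _ (hmem x hx))) (fun x hx => neg_le_neg (hFu _ (hmem x hx)))
    (by linarith) (by simpa using hend) (by simpa using hφv) (by simpa using hφu)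
  simpa using this

/-! ### One-sided derivatives and the vanishing viscosity limit -/

theorem hasDerivAt_const_add_integral {q : ℝ → ℝ} (hq : Continuous q) (x a c : ℝ) :
    HasDerivAt (fun z => c + ∫ t in a..z, q t) (q x) x :=
  (intervalIntegral.integral_hasDerivAt_right (hq.intervalIntegrable _ _)
    (hq.stronglyMeasurableAtFilter _ _) hq.continuousAt).const_add c

/-- The density need only agree with a continuous function on the right of `x`. This gives a
derivative even at the interface, where the density may jump. -/
theorem IsPrimitive.hasDerivWithinAt_Ici {g p q : ℝ → ℝ} (hg : IsPrimitive g p)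
    (hq : Continuous q) {x b : ℝ} (hxb : x < b) (h : ∀ t ∈ Set.Ioo x b, p t = q t) :
    HasDerivWithinAt g (q x) (Set.Ici x) x := by
  have h1 := (hasDerivAt_const_add_integral hq x x (g x)).hasDerivWithinAt
    (s := Set.Ici x)
  refine h1.congr_of_eventuallyEq ?_ (by simp)
  filter_upwards [Ico_mem_nhdsGE hxb] with z hz
  have h2 : ∫ t in x..z, q t = ∫ t in x..z, p t := by
    refine intervalIntegral.integral_congr_ae (Eventually.of_forall fun t ht => ?_)
    rw [Set.uIoc_of_le hz.1] at ht
    exact (h t ⟨ht.1, ht.2.trans_lt hz.2⟩).symm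
  rw [h2, ← hg.sub_eq]
  ring

theorem IsPrimitive.hasDerivWithinAt_Iic {g p q : ℝ → ℝ} (hg : IsPrimitive g p)
    (hq : Continuous q) {x a : ℝ} (hax : a < x) (h : ∀ t ∈ Set.Ioc a x, p t = q t) :
    HasDerivWithinAt g (q x) (Set.Iic x) x := by
  have h1 := (hasDerivAt_const_add_integral hq x x (g x)).hasDerivWithinAt
    (s := Set.Iic x)
  refine h1.congr_of_eventuallyEq ?_ (by simp)
  filter_upwards [Ioc_mem_nhdsLE hax] with z hz
  have h2 : ∫ t in x..z, q t = ∫ t in x..z, p t := by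
    refine intervalIntegral.integral_congr_ae (Eventually.of_forall fun t ht => ?_)
    rw [Set.uIoc_of_ge hz.2] at ht
    exact (h t ⟨hz.1.trans ht.1, ht.2⟩).symm
  rw [h2, ← hg.sub_eq]
  ring

theorem IsPrimitive.ae_eq_of_eq {g q r : ℝ → ℝ} (h : IsPrimitive g q) (h' : IsPrimitive g r) :
    ∀ᵐ x, q x = r x := by
  filter_upwards [h.ae_hasDerivAt, h'.ae_hasDerivAt] with x h1 h2
  exact h1.unique h2

theorem IsPrimitive.eq_setIntegral_Iic {F q : ℝ → ℝ} (h : IsPrimitive F q) (hq : Integrable q)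
    (hbot : Tendsto F atBot (𝓝 0)) (x : ℝ) : F x = ∫ t in Set.Iic x, q t := by
  have h1 := intervalIntegral_tendsto_integral_Iic x hq.integrableOn tendsto_id
  simp only [id, ← h.sub_eq] at h1
  have h2 := hbot.const_sub (F x)
  rw [sub_zero] at h2
  exact tendsto_nhds_unique h2 h1

theorem isPrimitive_setIntegral_Iic {q : ℝ → ℝ} (hq : Integrable q) :
    IsPrimitive (fun x => ∫ t in Set.Iic x, q t) q :=
  ⟨hq.locallyIntegrable, fun _ _ =>
    intervalIntegral.integral_Iic_sub_Iic hq.integrableOn hq.integrableOn⟩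

/-- A vanishing viscosity limit `u`, with total flux `F`. -/
structure InviscidProfile (f : ℝ → ℝ → ℝ) (lam : ℝ) (w u F : ℝ → ℝ) : Prop where
  integrable : Integrable u
  flux : IsPrimitive F fun x => (w x - u x) / lam
  tendsto_bot : Tendsto F atBot (𝓝 0)
  tendsto_top : Tendsto F atTop (𝓝 0)
  ae_eq : ∀ᵐ x, f x (u x) = F x

/-- `Fn n - F` is the integral of `(u - un n) / lam` over a half-line, so L¹ convergence of the
states gives uniform convergence of the fluxes. In the integrated equation for `un n`, the viscous
term is at most `ε n` and drops out. -/
theorem exists_inviscidProfile {f : ℝ → ℝ → ℝ} {fl fr : ℝ → ℝ} {L c lam : ℝ}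
    (hf : JumpFlux f fl fr L c) (hlam : 0 < lam) {w u : ℝ → ℝ} {ε : ℕ → ℝ} {un Fn : ℕ → ℝ → ℝ}
    (hw : ∀ᵐ x, 0 ≤ w x ∧ w x ≤ 1) (hε : ∀ n, 0 < ε n) (hε0 : Tendsto ε atTop (𝓝 0))
    (hP : ∀ n, ViscousProfile f lam (ε n) w (un n) (Fn n)) (hu : Integrable u)
    (hlim : Tendsto (fun n => ∫ x, |un n x - u x|) atTop (𝓝 0)) :
    ∃ F, InviscidProfile f lam w u F ∧ ∀ η > 0, ∀ᶠ n in atTop, ∀ x, |Fn n x - F x| ≤ η := by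
  have hwi := (hP 0).integrable_data
  have hq : Integrable fun x => (w x - u x) / lam := (hwi.sub hu).div_const lam
  set F : ℝ → ℝ := fun x => ∫ t in Set.Iic x, (w t - u t) / lam with hF
  have hFp : IsPrimitive F fun x => (w x - u x) / lam := isPrimitive_setIntegral_Iic hq
  have hclose : ∀ n x, |Fn n x - F x| ≤ (∫ x, |un n x - u x|) / lam := by
    intro n x
    have hqn : Integrable fun x => (w x - un n x) / lam :=
      (hwi.sub (hP n).integrable).div_const lam
    rw [(hP n).flux.eq_setIntegral_Iic hqn (hP n).tendsto_bot x, hF]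
    simp only []
    rw [← integral_sub hqn.integrableOn hq.integrableOn, ← integral_div, ← Real.norm_eq_abs]
    have hi : Integrable fun x => |un n x - u x| / lam :=
      ((hP n).integrable.sub hu).abs.div_const lam
    refine (norm_integral_le_integral_norm _).trans (le_trans (le_of_eq ?_)
      (setIntegral_le_integral (s := Set.Iic x) hi (Eventually.of_forall fun x => by positivity)))
    refine integral_congr_ae (Eventually.of_forall fun t => ?_)
    have e : (w t - un n t) / lam - (w t - u t) / lam = -(un n t - u t) / lam := by ring
    simp only [e, Real.norm_eq_abs, abs_div, abs_neg, abs_of_pos hlam]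
  have hunif : ∀ η > 0, ∀ᶠ n in atTop, ∀ x, |Fn n x - F x| ≤ η := by
    intro η hη
    have := hlim.div_const lam
    rw [zero_div] at this
    filter_upwards [this.eventually (gt_mem_nhds hη)] with n hn x
    exact (hclose n x).trans hn.le
  have hends : ∀ l : Filter ℝ, (∀ n, Tendsto (Fn n) l (𝓝 0)) → Tendsto F l (𝓝 0) := by
    intro l hl
    rw [Metric.tendsto_nhds]
    intro η hη
    obtain ⟨n, hn⟩ := (hunif (η / 2) (half_pos hη)).exists
    filter_upwards [Metric.tendsto_nhds.1 (hl n) (η / 2) (half_pos hη)] with x hx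
    have h1 := hn x
    rw [Real.dist_eq, sub_zero] at hx ⊢
    rw [abs_lt] at hx ⊢
    rw [abs_le] at h1
    constructor <;> linarith
  refine ⟨F, ⟨hu, hFp, hends _ fun n => (hP n).tendsto_bot, hends _ fun n => (hP n).tendsto_top,
    ?_⟩, hunif⟩
  have hfu := hf.integrable hu
  -- That `f(x, u) - F` integrates to zero over every interval is expressed by making it a density
  -- of the constant 0; a.e. uniqueness of densities then gives `f(x, u) = F`.
  have hzero : IsPrimitive (fun _ => (0 : ℝ)) fun x => f x (u x) - F x := by
    refine ⟨hfu.locallyIntegrable.sub hFp.continuous.locallyIntegrable, fun a b => ?_⟩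
    rw [sub_zero, intervalIntegral.integral_sub hfu.intervalIntegrable
      (hFp.continuous.intervalIntegrable _ _)]
    have l1 : Tendsto (fun n => ∫ x in a..b, f x (un n x)) atTop (𝓝 (∫ x in a..b, f x (u x))) := by
      rw [tendsto_iff_norm_sub_tendsto_zero]
      have h0 := hlim.const_mul L
      rw [mul_zero] at h0
      refine squeeze_zero (fun n => norm_nonneg _) (fun n => ?_) h0
      have hfn := hf.integrable (hP n).integrable
      rw [← intervalIntegral.integral_sub hfn.intervalIntegrable hfu.intervalIntegrable,
        ← integral_const_mul]
      have hi : Integrable fun x => L * |un n x - u x| :=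
        ((hP n).integrable.sub hu).abs.const_mul L
      have hi2 : Integrable fun x => ‖f x (un n x) - f x (u x)‖ := (hfn.sub hfu).norm
      refine intervalIntegral.norm_integral_le_integral_norm_uIoc.trans ?_
      refine (setIntegral_le_integral hi2 (Eventually.of_forall fun x => norm_nonneg _)).trans ?_
      exact integral_mono hi2 hi fun x => hf.lipschitz x _ _
    have l2 : Tendsto (fun n => ∫ x in a..b, Fn n x) atTop (𝓝 (∫ x in a..b, F x)) := by
      rw [tendsto_iff_norm_sub_tendsto_zero]
      have h0 := (hlim.div_const lam).mul_const |b - a|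
      rw [zero_div, zero_mul] at h0
      refine squeeze_zero (fun n => norm_nonneg _) (fun n => ?_) h0
      rw [← intervalIntegral.integral_sub ((hP n).continuous_flux.intervalIntegrable _ _)
        (hFp.continuous.intervalIntegrable _ _)]
      exact intervalIntegral.norm_integral_le_of_norm_le_const fun x _ => hclose n x
    have l3 : Tendsto (fun n => ε n * (un n b - un n a)) atTop (𝓝 0) := by
      rw [tendsto_zero_iff_norm_tendsto_zero]
      refine squeeze_zero (fun n => norm_nonneg _) (fun n => ?_) hε0
      have h0 := (hP n).nonneg hf hlam (hε n) (hw.mono fun x hx => hx.1)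
      have h1 := (hP n).le_one hf hlam (hε n) (hw.mono fun x hx => hx.2)
      rw [norm_mul, Real.norm_of_nonneg (hε n).le]
      exact mul_le_of_le_one_right (hε n).le
        (abs_le.2 ⟨by linarith [h0 b, h1 a], by linarith [h1 b, h0 a]⟩)
    have heq : ∀ n, (∫ x in a..b, f x (un n x)) - (∫ x in a..b, Fn n x) =
        ε n * (un n b - un n a) := by
      intro n
      rw [(hP n).state.sub_eq, intervalIntegral.integral_div, intervalIntegral.integral_sub
        (hf.integrable (hP n).integrable).intervalIntegrable
        ((hP n).continuous_flux.intervalIntegrable _ _), mul_div_cancel₀ _ (hε n).ne']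
    exact (tendsto_nhds_unique ((l1.sub l2).congr heq) l3).symm
  have hconst : IsPrimitive (fun _ => (0 : ℝ)) fun _ => (0 : ℝ) := ⟨locallyIntegrable_zero, by simp⟩
  filter_upwards [hzero.ae_eq_of_eq hconst] with x hx
  exact sub_eq_zero.1 hx

/-- A function positive a.e. on an interval has positive integral. The predicate `p` lets the chosen
point avoid any prescribed null set. -/
theorem exists_mem_Ioo_nonpos_of_integral_nonpos {g : ℝ → ℝ} (hg : Integrable g) {a b : ℝ}
    (hab : a < b) (h : ∫ x in a..b, g x ≤ 0) {p : ℝ → Prop} (hp : ∀ᵐ x, p x) :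
    ∃ x ∈ Set.Ioo a b, g x ≤ 0 ∧ p x := by
  by_contra! hcon
  have hpos : ∀ᵐ x ∂volume.restrict (Set.Ioo a b), 0 < g x := by
    filter_upwards [ae_restrict_mem measurableSet_Ioo, ae_restrict_of_ae hp] with x hx hpx
    by_contra! hle
    exact hcon x hx hle hpx
  rw [intervalIntegral.integral_of_le hab.le, integral_Ioc_eq_integral_Ioo] at h
  have hz := (integral_eq_zero_iff_of_nonneg_ae (hpos.mono fun x hx => hx.le)
    hg.integrableOn).1 (le_antisymm h (integral_nonneg_of_ae (hpos.mono fun x hx => hx.le)))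
  have : ∀ᵐ x ∂volume.restrict (Set.Ioo a b), False := by
    filter_upwards [hz, hpos] with x h1 h2
    simp only [Pi.zero_apply] at h1
    linarith
  rw [eventually_false_iff_eq_bot, ae_eq_bot, Measure.restrict_eq_zero, Real.volume_Ioo,
    ENNReal.ofReal_eq_zero] at this
  linarith

namespace JumpFlux

variable {f : ℝ → ℝ → ℝ} {fl fr : ℝ → ℝ} {L c : ℝ}

theorem continuous (hf : JumpFlux f fl fr L c) (x : ℝ) : Continuous (f x) := by
  have : f x = if x ≤ 0 then fl else fr := by
    funext s
    rw [hf.eq_ite]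
    split_ifs <;> rfl
  rw [this]
  split_ifs
  exacts [hf.continuous_left, hf.continuous_right]

/-- Near any point the flux is constant in `x` on either side. -/
theorem exists_sides (hf : JumpFlux f fl fr L c) (x₀ : ℝ) :
    ∃ r > 0, (∀ x ∈ Set.Ioo x₀ (x₀ + r), ∀ y ∈ Set.Ioo x₀ (x₀ + r), f x = f y) ∧
      ∀ x ∈ Set.Ioc (x₀ - r) x₀, ∀ y ∈ Set.Ioc (x₀ - r) x₀, f x = f y := by
  have hneg : ∀ {x y}, x ≤ 0 → y ≤ 0 → f x = f y := fun {x y} hx hy => by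
    funext s; rw [hf.eq_ite, hf.eq_ite y, if_pos hx, if_pos hy]
  have hpos : ∀ {x y}, 0 < x → 0 < y → f x = f y := fun {x y} hx hy => by
    funext s; rw [hf.eq_ite, hf.eq_ite y, if_neg hx.not_ge, if_neg hy.not_ge]
  rcases lt_trichotomy x₀ 0 with h | h | h
  · refine ⟨-x₀, by linarith, fun x hx y hy => hneg ?_ ?_, fun x hx y hy => hneg ?_ ?_⟩ <;>
      linarith [hx.2, hy.2]
  · subst h
    exact ⟨1, one_pos, fun x hx y hy => hpos hx.1 hy.1, fun x hx y hy => hneg hx.2 hy.2⟩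
  · refine ⟨x₀, h, fun x hx y hy => hpos ?_ ?_, fun x hx y hy => hpos ?_ ?_⟩ <;>
      linarith [hx.1, hy.1]

end JumpFlux

theorem ViscousProfile.hasDerivWithinAt_Ici {f : ℝ → ℝ → ℝ} {fl fr : ℝ → ℝ} {L c lam ε : ℝ}
    {w u F : ℝ → ℝ} (hf : JumpFlux f fl fr L c) (h : ViscousProfile f lam ε w u F) {x b y : ℝ}
    (hxb : x < b) (hy : ∀ t ∈ Set.Ioo x b, f t = f y) :
    HasDerivWithinAt u ((f y (u x) - F x) / ε) (Set.Ici x) x :=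
  h.state.hasDerivWithinAt_Ici (q := fun x => (f y (u x) - F x) / ε)
    ((((hf.continuous y).comp h.continuous).sub h.continuous_flux).div_const ε) hxb
    fun t ht => by rw [hy t ht]

theorem ViscousProfile.hasDerivWithinAt_Iic {f : ℝ → ℝ → ℝ} {fl fr : ℝ → ℝ} {L c lam ε : ℝ}
    {w u F : ℝ → ℝ} (hf : JumpFlux f fl fr L c) (h : ViscousProfile f lam ε w u F) {x a y : ℝ}
    (hax : a < x) (hy : ∀ t ∈ Set.Ioc a x, f t = f y) :
    HasDerivWithinAt u ((f y (u x) - F x) / ε) (Set.Iic x) x :=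
  h.state.hasDerivWithinAt_Iic (q := fun x => (f y (u x) - F x) / ε)
    ((((hf.continuous y).comp h.continuous).sub h.continuous_flux).div_const ε) hax
    fun t ht => by rw [hy t ht]

/-- The total fluxes of two vanishing viscosity limits with the same datum are ordered. -/
theorem InviscidProfile.flux_le {f : ℝ → ℝ → ℝ} {fl fr : ℝ → ℝ} {L c lam : ℝ}
    (hf : JumpFlux f fl fr L c) (hlam : 0 < lam) {w u v F G : ℝ → ℝ} {ε δ : ℕ → ℝ}
    {un Fn vn Gn : ℕ → ℝ → ℝ} (hε : ∀ n, 0 < ε n) (hδ : ∀ n, 0 < δ n)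
    (hu : InviscidProfile f lam w u F) (hv : InviscidProfile f lam w v G)
    (hP : ∀ n, ViscousProfile f lam (ε n) w (un n) (Fn n))
    (hQ : ∀ n, ViscousProfile f lam (δ n) w (vn n) (Gn n))
    (hFn : ∀ η > 0, ∀ᶠ n in atTop, ∀ x, |Fn n x - F x| ≤ η)
    (hGn : ∀ η > 0, ∀ᶠ n in atTop, ∀ x, |Gn n x - G x| ≤ η)
    (hun : ∀ᵐ x, Tendsto (fun n => un n x) atTop (𝓝 (u x)))
    (hvn : ∀ᵐ x, Tendsto (fun n => vn n x) atTop (𝓝 (v x))) (x : ℝ) : G x ≤ F x := by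
  by_contra! hcon
  have hFc := hu.flux.continuous
  have hGc := hv.flux.continuous
  have hmax : ∃ x₀, ∀ y, G y - F y ≤ G x₀ - F x₀ := by
    refine (hGc.sub hFc).exists_forall_ge' x ?_
    have hx : (0 : ℝ) < G x - F x := sub_pos.2 hcon
    rw [cocompact_eq_atBot_atTop, eventually_sup]
    constructor
    · have := hv.tendsto_bot.sub hu.tendsto_bot
      rw [sub_zero] at this
      filter_upwards [this.eventually (gt_mem_nhds hx)] with y hy using hy.le
    · have := hv.tendsto_top.sub hu.tendsto_top
      rw [sub_zero] at this
      filter_upwards [this.eventually (gt_mem_nhds hx)] with y hy using hy.le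
  obtain ⟨x₀, hx₀⟩ := hmax
  set M := G x₀ - F x₀ with hM
  have hMpos : 0 < M := (sub_pos.2 hcon).trans_le (hx₀ x)
  obtain ⟨r₁, hr₁, hright, hleft⟩ := hf.exists_sides x₀
  obtain ⟨r₂, hr₂, hFr⟩ := Metric.continuousAt_iff.1 (hFc.continuousAt : ContinuousAt F x₀) (M / 9)
    (by positivity)
  obtain ⟨r₃, hr₃, hGr⟩ := Metric.continuousAt_iff.1 (hGc.continuousAt : ContinuousAt G x₀) (M / 9)
    (by positivity)
  set r := min r₁ (min r₂ r₃) with hr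
  have hrpos : 0 < r := lt_min hr₁ (lt_min hr₂ hr₃)
  have hrr₁ : r ≤ r₁ := min_le_left _ _
  have hrr₂ : r ≤ r₂ := (min_le_right _ _).trans (min_le_left _ _)
  have hrr₃ : r ≤ r₃ := (min_le_right _ _).trans (min_le_right _ _)
  have hnear : ∀ y, |y - x₀| < r → F y < F x₀ + M / 9 ∧ G x₀ - M / 9 < G y := by
    intro y hy
    have h1 := hFr (show dist y x₀ < r₂ by rw [Real.dist_eq]; linarith)
    have h2 := hGr (show dist y x₀ < r₃ by rw [Real.dist_eq]; linarith)
    rw [Real.dist_eq, abs_lt] at h1 h2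
    exact ⟨by linarith, by linarith⟩
  have hGF : IsPrimitive (fun x => G x - F x) fun x => (u x - v x) / lam := by
    have := hv.flux.sub hu.flux
    have e : (fun x => (w x - v x) / lam - (w x - u x) / lam) = fun x => (u x - v x) / lam := by
      funext x; ring
    rwa [e] at this
  have hi : Integrable fun x => (u x - v x) / lam := (hu.integrable.sub hv.integrable).div_const lam
  have hgood : ∀ᵐ x, f x (u x) = F x ∧ f x (v x) = G x ∧
      Tendsto (fun n => un n x) atTop (𝓝 (u x)) ∧ Tendsto (fun n => vn n x) atTop (𝓝 (v x)) := by
    filter_upwards [hu.ae_eq, hv.ae_eq, hun, hvn] with x h1 h2 h3 h4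
    exact ⟨h1, h2, h3, h4⟩
  -- `G - F` does not increase from `x₀` to `x₀ + r`, so `u ≤ v` at some good point on the right;
  -- symmetrically `v ≤ u` at some good point on the left.
  obtain ⟨x₁, hx₁, huv₁, hu₁, hv₁, hun₁, hvn₁⟩ := exists_mem_Ioo_nonpos_of_integral_nonpos hi
    (show x₀ < x₀ + r by linarith) (by rw [← hGF.sub_eq]; linarith [hx₀ (x₀ + r)]) hgood
  obtain ⟨x₂, hx₂, huv₂, hu₂, hv₂, hun₂, hvn₂⟩ := exists_mem_Ioo_nonpos_of_integral_nonpos hi.neg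
    (show x₀ - r < x₀ by linarith) (by
      simp only [Pi.neg_apply]
      rw [intervalIntegral.integral_neg, ← hGF.sub_eq]; linarith [hx₀ (x₀ - r)]) hgood
  have hn₁ := hnear x₁ (abs_lt.2 ⟨by linarith [hx₁.1], by linarith [hx₁.2]⟩)
  have hn₂ := hnear x₂ (abs_lt.2 ⟨by linarith [hx₂.1], by linarith [hx₂.2]⟩)
  have huv₁' : u x₁ < v x₁ := by
    have h1 : u x₁ ≤ v x₁ := by
      rw [div_le_iff₀ hlam, zero_mul] at huv₁
      linarith
    -- Equality of the states would give `F = G` at this point, whereas the two fluxes are separated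
    -- near `x₀`.
    refine lt_of_le_of_ne h1 fun heq => ?_
    rw [heq, hv₁] at hu₁
    linarith
  have huv₂' : v x₂ < u x₂ := by
    have h1 : v x₂ ≤ u x₂ := by
      rw [Pi.neg_apply, neg_nonpos, le_div_iff₀ hlam, zero_mul] at huv₂
      linarith
    refine lt_of_le_of_ne h1 fun heq => ?_
    rw [heq, hu₂] at hv₂
    linarith
  -- Of the gap `M`, each side gives up `M / 9` to continuity near `x₀` and `M / 9` to uniform
  -- convergence of the fluxes. As `2M / 9 < M / 3`, the approximate fluxes are separated by `α <
  -- β`.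
  set α := F x₀ + M / 3 with hα
  set β := G x₀ - M / 3 with hβ
  have ev : ∀ {y}, Tendsto (fun n => un n y) atTop (𝓝 (u y)) →
      Tendsto (fun n => vn n y) atTop (𝓝 (v y)) → f y (u y) = F y → f y (v y) = G y →
      F y < F x₀ + M / 9 → G x₀ - M / 9 < G y →
      ∀ᶠ n in atTop, f y (un n y) < β ∧ α < f y (vn n y) := by
    intro y h1 h2 h3 h4 h5 h6
    have t1 := ((hf.continuous y).tendsto _).comp h1
    have t2 := ((hf.continuous y).tendsto _).comp h2
    rw [h3] at t1
    rw [h4] at t2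
    exact (t1.eventually (gt_mem_nhds (by linarith))).and
      (t2.eventually (lt_mem_nhds (by linarith)))
  obtain ⟨n, hFn, hGn, h1, h2, h3, h4⟩ := ((hFn (M / 9) (by positivity)).and
    ((hGn (M / 9) (by positivity)).and ((hun₁.eventually_lt hvn₁ huv₁').and
      ((hvn₂.eventually_lt hun₂ huv₂').and ((ev hun₁ hvn₁ hu₁ hv₁ hn₁.1 hn₁.2).and
        (ev hun₂ hvn₂ hu₂ hv₂ hn₂.1 hn₂.2)))))).exists
  have bF : ∀ y, |y - x₀| < r → Fn n y ≤ α := fun y hy => by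
    linarith [(hnear y hy).1, (abs_le.1 (hFn y)).2]
  have bG : ∀ y, |y - x₀| < r → β ≤ Gn n y := fun y hy => by
    linarith [(hnear y hy).2, (abs_le.1 (hGn y)).1]
  have sR : ∀ y ∈ Set.Ico x₀ x₁, |y - x₀| < r := fun y hy =>
    abs_lt.2 ⟨by linarith [hy.1], by linarith [hy.2, hx₁.2]⟩
  have sL : ∀ y ∈ Set.Ioc x₂ x₀, |y - x₀| < r := fun y hy =>
    abs_lt.2 ⟨by linarith [hy.1, hx₂.1], by linarith [hy.2]⟩
  have cR : ∀ y ∈ Set.Ico x₀ x₁, ∀ t ∈ Set.Ioo y x₁, f t = f x₁ := fun y hy t ht =>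
    hright t ⟨hy.1.trans_lt ht.1, by linarith [ht.2, hx₁.2]⟩ x₁ ⟨hx₁.1, by linarith [hx₁.2]⟩
  have cL : ∀ y ∈ Set.Ioc x₂ x₀, ∀ t ∈ Set.Ioc x₂ y, f t = f x₂ := fun y hy t ht =>
    hleft t ⟨by linarith [ht.1, hx₂.1], ht.2.trans hy.2⟩ x₂ ⟨by linarith [hx₂.1], hx₂.2.le⟩
  have hαβ : α < β := by linarith
  -- Transport back to `x₀` from the right gives `un n x₀ < vn n x₀`; from the left it gives the
  -- reverse.
  have r1 := lt_of_viscous_layers hx₁.1 (hε n) (hδ n) (hP n).continuous (hQ n).continuous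
    (fun y hy => (hP n).hasDerivWithinAt_Ici hf hy.2 (cR y hy))
    (fun y hy => (hQ n).hasDerivWithinAt_Ici hf hy.2 (cR y hy))
    (fun y hy => bF y (sR y hy)) (fun y hy => bG y (sR y hy)) hαβ h1 h3.1 h3.2
  have r2 := lt_of_viscous_layers_left hx₂.2 (hε n) (hδ n) (hP n).continuous (hQ n).continuous
    (fun y hy => (hP n).hasDerivWithinAt_Iic hf hy.1 (cL y hy))
    (fun y hy => (hQ n).hasDerivWithinAt_Iic hf hy.1 (cL y hy))
    (fun y hy => bF y (sL y hy)) (fun y hy => bG y (sL y hy)) hαβ h2 h4.1 h4.2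
  exact lt_asymm r1 r2

/-! ### Convergence of the viscous resolvents -/

theorem tendsto_integral_abs_translate_sub (w : ℝ →₁[volume] ℝ) :
    Tendsto (fun t : ℝ => ∫ x, |w (x + t) - w x|) (𝓝 0) (𝓝 0) := by
  let g : ℝ → C(ℝ, ℝ) := fun t => ⟨fun x => x + t, by fun_prop⟩
  have hg : Continuous g := ContinuousMap.continuous_of_continuous_uncurry _ (by
    unfold Function.uncurry; simp only [g, ContinuousMap.coe_mk]; fun_prop)
  have hm : ∀ t, MeasurePreserving (g t) volume volume := fun t =>
    measurePreserving_add_right volume t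
  have h1 := (tendsto_const_nhds (x := w) (f := 𝓝 (0 : ℝ))).compMeasurePreservingLp
    (hg.tendsto 0) hm (hm 0) ENNReal.one_ne_top
  have h2 := tendsto_iff_norm_sub_tendsto_zero.1 h1
  refine h2.congr fun t => ?_
  rw [norm_sub_eq_integral_abs]
  refine integral_congr_ae ?_
  filter_upwards [Lp.coeFn_compMeasurePreserving w (hm t),
    Lp.coeFn_compMeasurePreserving w (hm 0)] with x hx hx0
  rw [hx, hx0]
  simp [g]

theorem exists_subseq_tendsto_ae {un : ℕ → ℝ →₁[volume] ℝ} {u : ℝ →₁[volume] ℝ}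
    (h : Tendsto un atTop (𝓝 u)) :
    ∃ φ : ℕ → ℕ, StrictMono φ ∧ ∀ᵐ x, Tendsto (fun n => un (φ n) x) atTop (𝓝 (u x)) :=
  (tendstoInMeasure_of_tendsto_Lp h).exists_seq_tendsto_ae

section

variable {f : ℝ → ℝ → ℝ} {fl fr : ℝ → ℝ} {L c lam : ℝ}

theorem isWeakSolution_viscousResolvent (hf : JumpFlux f fl fr L c) (hlam : 0 < lam) {ε : ℝ}
    (hε : 0 < ε) (w : ℝ →₁[volume] ℝ) :
    IsWeakSolution f lam ε w (viscousResolvent f lam ε w) := by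
  have h := exists_isWeakSolution hf hlam hε w
  rw [viscousResolvent, dif_pos h]
  exact h.choose_spec

theorem norm_viscousResolvent_sub_le (hf : JumpFlux f fl fr L c) (hlam : 0 < lam) {ε : ℝ}
    (hε : 0 < ε) (w₁ w₂ : ℝ →₁[volume] ℝ) :
    ‖viscousResolvent f lam ε w₁ - viscousResolvent f lam ε w₂‖ ≤ ‖w₁ - w₂‖ :=
  (isWeakSolution_viscousResolvent hf hlam hε w₁).norm_sub_le hf hlam hε
    (isWeakSolution_viscousResolvent hf hlam hε w₂)

theorem exists_viscousProfile_viscousResolvent (hf : JumpFlux f fl fr L c) (hlam : 0 < lam) {ε : ℝ}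
    (hε : 0 < ε) (w : ℝ →₁[volume] ℝ) :
    ∃ u F, u =ᵐ[volume] viscousResolvent f lam ε w ∧ ViscousProfile f lam ε w u F :=
  exists_viscousProfile hf hε.ne' (L1.integrable_coeFn w) (L1.integrable_coeFn _)
    (isWeakSolution_viscousResolvent hf hlam hε w)

theorem viscousResolvent_mem_unitDomain (hf : JumpFlux f fl fr L c) (hlam : 0 < lam) {ε : ℝ}
    (hε : 0 < ε) {w : ℝ →₁[volume] ℝ} (hw : w ∈ unitDomain) :
    viscousResolvent f lam ε w ∈ unitDomain := by
  obtain ⟨u, F, hu, hP⟩ := exists_viscousProfile_viscousResolvent hf hlam hε w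
  have hw' : ∀ᵐ x, 0 ≤ w x ∧ w x ≤ 1 := hw
  show ∀ᵐ x, _
  filter_upwards [hu] with x hx
  rw [← hx]
  exact ⟨hP.nonneg hf hlam hε (hw'.mono fun x hx => hx.1) x,
    hP.le_one hf hlam hε (hw'.mono fun x hx => hx.2) x⟩

theorem isClosed_unitDomain : IsClosed unitDomain := by
  rw [← isSeqClosed_iff_isClosed]
  intro un u hun hlim
  obtain ⟨φ, -, hφ⟩ := exists_subseq_tendsto_ae hlim
  have hall : ∀ᵐ x, ∀ n, 0 ≤ un n x ∧ un n x ≤ 1 := ae_all_iff.2 hun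
  show ∀ᵐ x, _
  filter_upwards [hφ, hall] with x h1 h2
  exact ⟨ge_of_tendsto' h1 fun n => (h2 _).1, le_of_tendsto' h1 fun n => (h2 _).2⟩

theorem exists_subseq_tendsto_viscousResolvent (hf : JumpFlux f fl fr L c) (hlam : 0 < lam)
    {w : ℝ →₁[volume] ℝ} (hw : w ∈ unitDomain) {ε : ℕ → ℝ} (hε : ∀ n, 0 < ε n)
    (hε1 : ∀ n, ε n ≤ 1) :
    ∃ (φ : ℕ → ℕ) (u : ℝ →₁[volume] ℝ), StrictMono φ ∧
      Tendsto (fun n => viscousResolvent f lam (ε (φ n)) w) atTop (𝓝 u) := by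
  have hw' : ∀ᵐ x, 0 ≤ w x ∧ w x ≤ 1 := hw
  have hwi := L1.integrable_coeFn w
  choose un Fn hun hP using fun n => exists_viscousProfile_viscousResolvent hf hlam (hε n) w
  obtain ⟨φ, hφ, hcauchy⟩ := exists_subseq_cauchy (u := un) (fun n => (hP n).continuous)
    (fun n => (hP n).integrable)
    (fun n => (hP n).nonneg hf hlam (hε n) (hw'.mono fun x hx => hx.1))
    (fun n => (hP n).le_one hf hlam (hε n) (hw'.mono fun x hx => hx.2))
    (fun η hη => by
      obtain ⟨δ, hδ, hδ'⟩ := Metric.eventually_nhds_iff.1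
        ((tendsto_integral_abs_translate_sub w).eventually (gt_mem_nhds (half_pos hη)))
      -- `η / 10` makes the term `5 * t` at most `η / 2`; halving `δ` makes the distance strictly
      -- less than `δ`.
      refine ⟨min (δ / 2) (η / 10), by positivity, fun n t ht => ?_⟩
      have h1 := ht.2.trans (min_le_left _ _)
      have h2 := ht.2.trans (min_le_right _ _)
      have h3 := (hP n).integral_abs_translate_le hf hlam (hε n) hw' ht.1
      have h4 := hδ' (y := t) (by rw [Real.dist_eq, sub_zero, abs_of_nonneg ht.1]; linarith)
      linarith)
    (fun η hη => by
      have l1 := (intervalIntegral_tendsto_integral hwi tendsto_neg_atTop_atBot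
        tendsto_id).const_sub (∫ x, w x)
      rw [sub_self] at l1
      have l2 := tendsto_const_nhds (x := 2 * lam * (L * (∫ x, w x) + 1)) (f := atTop) |>.div_atTop
        (tendsto_id (α := ℝ))
      obtain ⟨R, hR1, hR2, hR3⟩ := ((l1.eventually (gt_mem_nhds (half_pos hη))).and
        ((l2.eventually (gt_mem_nhds (half_pos hη))).and (eventually_gt_atTop 0))).exists
      refine ⟨2 * R, by positivity, fun n => ?_⟩
      have h1 := (hP n).tail_le hf hlam (hε n) hw' hR3
      -- The bound `ε n ≤ 1` makes the choice of `R` independent of `n`.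
      have h2 : 2 * lam * (L * (∫ x, w x) + ε n) / R ≤ 2 * lam * (L * (∫ x, w x) + 1) / R := by
        gcongr
        exact hε1 n
      simp only [id] at hR1 hR2
      linarith)
  have hc : CauchySeq fun n => viscousResolvent f lam (ε (φ n)) w := by
    rw [Metric.cauchySeq_iff]
    intro η hη
    obtain ⟨N, hN⟩ := hcauchy (η / 2) (half_pos hη)
    refine ⟨N, fun m hm n hn => ?_⟩
    rw [dist_eq_norm, norm_sub_eq_integral_abs]
    refine lt_of_le_of_lt (le_trans (le_of_eq (integral_congr_ae ?_)) (hN m hm n hn))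
      (half_lt_self hη)
    filter_upwards [hun (φ m), hun (φ n)] with x h1 h2
    rw [h1, h2]
  obtain ⟨u, hu⟩ := cauchySeq_tendsto_of_complete hc
  exact ⟨φ, u, hφ, hu⟩

/-- The flux ordering, used in both directions along a.e. convergent subsequences, gives `F = G`.
Their densities `(w - u) / lam` and `(w - v) / lam` then agree a.e. -/
theorem eq_of_tendsto_viscousResolvent (hf : JumpFlux f fl fr L c) (hlam : 0 < lam)
    {w u v : ℝ →₁[volume] ℝ} (hw : w ∈ unitDomain) {ε δ : ℕ → ℝ} (hε : ∀ n, 0 < ε n)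
    (hδ : ∀ n, 0 < δ n) (hε0 : Tendsto ε atTop (𝓝 0)) (hδ0 : Tendsto δ atTop (𝓝 0))
    (hu : Tendsto (fun n => viscousResolvent f lam (ε n) w) atTop (𝓝 u))
    (hv : Tendsto (fun n => viscousResolvent f lam (δ n) w) atTop (𝓝 v)) : u = v := by
  have hw' : ∀ᵐ x, 0 ≤ w x ∧ w x ≤ 1 := hw
  obtain ⟨φ, hφ, hφu⟩ := exists_subseq_tendsto_ae hu
  obtain ⟨ψ, hψ, hψv⟩ := exists_subseq_tendsto_ae hv
  choose un Fn hun hP using fun n => exists_viscousProfile_viscousResolvent hf hlam (hε (φ n)) w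
  choose vn Gn hvn hQ using fun n => exists_viscousProfile_viscousResolvent hf hlam (hδ (ψ n)) w
  have hL1 : ∀ {δ : ℕ → ℝ} {z : ℝ →₁[volume] ℝ} {zn : ℕ → ℝ → ℝ},
      (∀ n, zn n =ᵐ[volume] viscousResolvent f lam (δ n) w) →
      Tendsto (fun n => viscousResolvent f lam (δ n) w) atTop (𝓝 z) →
      Tendsto (fun n => ∫ x, |zn n x - z x|) atTop (𝓝 0) := by
    intro δ z zn h1 h2
    refine (tendsto_iff_norm_sub_tendsto_zero.1 h2).congr fun n => ?_
    rw [norm_sub_eq_integral_abs]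
    refine integral_congr_ae ?_
    filter_upwards [h1 n] with x hx
    rw [hx]
  obtain ⟨F, hF, hFn⟩ := exists_inviscidProfile hf hlam hw' (fun n => hε (φ n))
    (hε0.comp hφ.tendsto_atTop) hP (L1.integrable_coeFn u) (hL1 hun (hu.comp hφ.tendsto_atTop))
  obtain ⟨G, hG, hGn⟩ := exists_inviscidProfile hf hlam hw' (fun n => hδ (ψ n))
    (hδ0.comp hψ.tendsto_atTop) hQ (L1.integrable_coeFn v) (hL1 hvn (hv.comp hψ.tendsto_atTop))
  have hua : ∀ᵐ x, Tendsto (fun n => un n x) atTop (𝓝 (u x)) := by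
    filter_upwards [hφu, ae_all_iff.2 hun] with x h1 h2
    exact h1.congr fun n => (h2 n).symm
  have hva : ∀ᵐ x, Tendsto (fun n => vn n x) atTop (𝓝 (v x)) := by
    filter_upwards [hψv, ae_all_iff.2 hvn] with x h1 h2
    exact h1.congr fun n => (h2 n).symm
  have hFG : F = G := funext fun x => le_antisymm
    (InviscidProfile.flux_le hf hlam (fun n => hδ (ψ n)) (fun n => hε (φ n)) hG hF hQ hP hGn hFn
      hva hua x)
    (InviscidProfile.flux_le hf hlam (fun n => hε (φ n)) (fun n => hδ (ψ n)) hF hG hP hQ hFn hGn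
      hua hva x)
  refine Lp.ext ?_
  have hF' := hF.flux
  rw [hFG] at hF'
  filter_upwards [hF'.ae_eq_of_eq hG.flux] with x hx
  rw [div_left_inj' hlam.ne'] at hx
  linarith

/-- The candidate is a subsequential limit along `1 / (n + 1)`. Every other sequence `ε → 0+` has a
convergent subsequence, whose limit must be the same, so the whole family converges. -/
theorem exists_tendsto_viscousResolvent (hf : JumpFlux f fl fr L c) (hlam : 0 < lam)
    {w : ℝ →₁[volume] ℝ} (hw : w ∈ unitDomain) :
    ∃ u : ℝ →₁[volume] ℝ,
      Tendsto (fun ε : ℝ => viscousResolvent f lam ε w) (𝓝[>] 0) (𝓝 u) := by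
  have hδ : ∀ n : ℕ, 0 < 1 / ((n : ℝ) + 1) := fun n => by positivity
  have hδ1 : ∀ n : ℕ, 1 / ((n : ℝ) + 1) ≤ 1 := fun n => by
    rw [div_le_one (by positivity)]
    linarith [n.cast_nonneg (α := ℝ)]
  obtain ⟨ψ, u, hψ, hu⟩ := exists_subseq_tendsto_viscousResolvent hf hlam hw hδ hδ1
  refine ⟨u, tendsto_of_subseq_tendsto fun ε hε => ?_⟩
  rw [tendsto_nhdsWithin_iff] at hε
  -- Shifting the index by `N` makes every term satisfy `0 < ε ≤ 1`, as the compactness statement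
  -- requires.
  obtain ⟨N, hN⟩ := eventually_atTop.1 (hε.2.and (hε.1.eventually (ge_mem_nhds one_pos)))
  have hε0 : ∀ n, 0 < ε (n + N) := fun n => (hN _ (Nat.le_add_left _ _)).1
  obtain ⟨φ, v, hφ, hv⟩ := exists_subseq_tendsto_viscousResolvent hf hlam hw hε0
    fun n => (hN _ (Nat.le_add_left _ _)).2
  refine ⟨fun n => φ n + N, ?_⟩
  have huv : v = u := eq_of_tendsto_viscousResolvent hf hlam hw (fun n => hε0 (φ n))
    (fun n => hδ (ψ n)) (((tendsto_add_atTop_iff_nat N).2 hε.1).comp hφ.tendsto_atTop)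
    (tendsto_one_div_add_atTop_nhds_zero_nat.comp hψ.tendsto_atTop) hv hu
  rwa [huv] at hv

end

theorem mainTheorem2 (f : ℝ → ℝ → ℝ) (hf : FluxF1 f) (lam : ℝ) (hlam : 0 < lam) :
    -- the viscous resolvent is well defined on `L¹(ℝ)`, and maps `D` into `D`
    (∀ ε : ℝ, 0 < ε →
      (∀ w : ℝ →₁[volume] ℝ, ∃! u : ℝ →₁[volume] ℝ, IsWeakSolution f lam ε w u) ∧
      (∀ w ∈ unitDomain, viscousResolvent f lam ε w ∈ unitDomain)) ∧
    -- it converges on `D` as `ε → 0+` to a unique limit, which is a contraction of `D`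
    ∃ J : unitDomain → unitDomain,
      (∀ w : unitDomain,
        Tendsto (fun ε : ℝ => viscousResolvent f lam ε w) (𝓝[>] 0)
          (𝓝 (J w : ℝ →₁[volume] ℝ))) ∧
      (∀ (w : unitDomain) (u : ℝ →₁[volume] ℝ),
        Tendsto (fun ε : ℝ => viscousResolvent f lam ε w) (𝓝[>] 0) (𝓝 u) →
          u = J w) ∧
      (∀ w₁ w₂ : unitDomain,
        ‖(J w₁ : ℝ →₁[volume] ℝ) - J w₂‖ ≤ ‖(w₁ : ℝ →₁[volume] ℝ) - w₂‖) := by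
  obtain ⟨fl, fr, L, c, hF⟩ := hf.exists_jumpFlux
  refine ⟨fun ε hε => ⟨fun w => ?_, fun w hw => viscousResolvent_mem_unitDomain hF hlam hε hw⟩, ?_⟩
  · obtain ⟨u, hu⟩ := exists_isWeakSolution hF hlam hε w
    refine ⟨u, hu, fun v hv => ?_⟩
    have h := IsWeakSolution.norm_sub_le hF hlam hε hv hu
    rw [sub_self, norm_zero] at h
    exact sub_eq_zero.1 (norm_le_zero_iff.1 h)
  · choose J hJ using fun w : unitDomain => exists_tendsto_viscousResolvent hF hlam w.2
    refine ⟨fun w => ⟨J w, isClosed_unitDomain.mem_of_tendsto (hJ w) ?_⟩, hJ,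
      fun w u hu => tendsto_nhds_unique hu (hJ w), fun w₁ w₂ => ?_⟩
    · filter_upwards [self_mem_nhdsWithin] with ε hε
      exact viscousResolvent_mem_unitDomain hF hlam hε w.2
    · refine le_of_tendsto ((hJ w₁).sub (hJ w₂)).norm ?_
      filter_upwards [self_mem_nhdsWithin] with ε hε
      exact norm_viscousResolvent_sub_le hF hlam hε _ _
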